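/- Let $\Omega\subset\mathbb{R}^2$ be convex and compact, let $h>0$, $\theta\in\mathbb{R}$, $\xi\in\mathbb{R}^2$, let $R_\theta$ be the rotation of angle $\theta$, and let $X:=\Omega\cap hR_\theta(\xi+\mathbb{Z}^2)$, $N:=\#X$, $\operatorname{diam}_h(\Omega):=h^{-1}\operatorname{diam}(\Omega)$. Let $\operatorname{Conv}(X)$ be the set of restrictions to $X$ of convex functions $U:\Omega\to\mathbb{R}$. A vector $e\in\mathbb{Z}^2$ is irreducible if its coordinates are coprime. If moreover $\|e\|>1$, its parents are the unique $f,g\in\mathbb{Z}^2$ with $e=f+g$, $\det(f,g)=1$ and $\langle f,g\rangle\ge 0$; unit vectors have no parents. For $x\in X$ put $\mathcal V_{\max}(x):=\{e\in\mathbb{Z}^2\text{ irreducible}:\ x+hR_\theta e\in X\}$. A family of stencils on $X$ is a family $\mathcal V=(\mathcal V(x))_{x\in X}$ of sets $\mathcal V(x)\subset\mathcal V_{\max}(x)$ such that, for every $x\in X$, (Stability) each parent $f\in\mathcal V_{\max}(x)$ of an element $e\in\mathcal V(x)$ belongs to $\mathcal V(x)$, and (Visibility) $\mathcal V(x)$ and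 $\mathcal V_{\max}(x)$ generate the same convex cone in $\mathbb{R}^2$ (the cone generated by $\emptyset$ being $\{0\}$). Families are ordered by inclusion at every $x$, and $\#\mathcal V:=\#\{(x,e):x\in X,\ e\in\mathcal V(x)\}$. Write $e_*:=hR_\theta e$. The cone $\operatorname{Conv}(\mathcal V)$ is the set of all $u:X\to\mathbb{R}$ such that for all $x\in X$: 1. $u(x+e_*)-2u(x)+u(x-e_*)\ge 0$ for all $e\in\mathcal V(x)$ such that $x\pm e_*\in X$; 2. $u(x+e_*)+u(x-f_*)+u(x-g_*)-3u(x)\ge 0$ for all $e\in\mathcal V(x)$ with $\|e\|>1$, of parents $f,g$, such that $x+e_*,\,x-f_*,\,x-g_*\in X$; 3. $u(x+e_*)-u(x+f_*)-u(x+g_*)+u(x)\ge 0$ for all $e\in\mathcal V_{\max}(x)\setminus\mathcal V(x)$ with $\|e\|>1$ whose two parents $f,g$ belong to $\mathcal V(x)$. Proposition. There is a universal constant $C$ (independent of $\Omega,h,\theta,\xi,u$) such that for every $u\in\operatorname{Conv}(X)$ there is a smallest (for inclusion) family of stencils $\mathcal V$ on $X$ with $u\in\operatorname{Conv}(\mathcal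 V)$, and it satisfies $$\#\mathcal V\le C\,N\,\operatorname{diam}_h(\Omega).$$ -/

import Mathlib

namespace GridConvex

/-- The Euclidean plane `ℝ²`. -/
abbrev Plane := EuclideanSpace ℝ (Fin 2)

/-- The canonical embedding of `ℤ²` in the plane. -/
noncomputable def lat (e : ℤ × ℤ) : Plane := !₂[(e.1 : ℝ), (e.2 : ℝ)]

/-- The rotation `R_θ` of angle `θ`. -/
noncomputable def rot (θ : ℝ) (v : Plane) : Plane :=
  !₂[Real.cos θ * v 0 - Real.sin θ * v 1, Real.sin θ * v 0 + Real.cos θ * v 1]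

/-- The grid `Ω ∩ h R_θ (ξ + ℤ²)`. -/
def grid (Ω : Set Plane) (h θ : ℝ) (ξ : Plane) : Set Plane :=
  Ω ∩ Set.range fun z : ℤ × ℤ => h • rot θ (ξ + lat z)

/-- The displacement `h R_θ e` of the plane which corresponds to the offset `e ∈ ℤ²`. -/
noncomputable def disp (h θ : ℝ) (e : ℤ × ℤ) : Plane := h • rot θ (lat e)

/-- Irreducible elements of `ℤ²`: those with coprime coordinates. -/
def Irred (e : ℤ × ℤ) : Prop := Int.gcd e.1 e.2 = 1

/-- `(f, g)` is a direct acute basis of `ℤ²`: `det (f, g) = 1` and `⟨f, g⟩ ≥ 0`. -/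
def IsDirectAcuteBasis (f g : ℤ × ℤ) : Prop :=
  f.1 * g.2 - f.2 * g.1 = 1 ∧ 0 ≤ f.1 * g.1 + f.2 * g.2

/-- `(f, g)` are the parents of `e`: a direct acute basis of `ℤ²` with sum `e`.
Every irreducible `e` with `‖e‖ > 1` has exactly one such pair; other vectors have none. -/
def AreParents (e f g : ℤ × ℤ) : Prop := IsDirectAcuteBasis f g ∧ f + g = e

/-- `f` is one of the two parents of `e`. -/
def IsParent (e f : ℤ × ℤ) : Prop := ∃ g, AreParents e f g ∨ AreParents e g f

/-- `Conv(X)`: the restrictions to `X ⊆ Ω` of the convex functions on `Ω`. -/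
def Conv (Ω X : Set Plane) : Set (X → ℝ) :=
  {u | ∃ U : Plane → ℝ, ConvexOn ℝ Ω U ∧ ∀ x : X, u x = U x}

/-- The maximal stencils: all irreducible offsets from `x` to points of `X`. -/
def maxStencil (h θ : ℝ) (X : Set Plane) (x : X) : Set (ℤ × ℤ) :=
  {e | Irred e ∧ (x : Plane) + disp h θ e ∈ X}

/-- The convex cone of `ℝ²` (apex `0` included) generated by a set of vectors of `ℤ²`. -/
noncomputable def cone (A : Set (ℤ × ℤ)) : PointedCone ℝ Plane := PointedCone.hull ℝ (lat '' A)

/-- Families of stencils on `X`. -/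
structure IsStencils (h θ : ℝ) (X : Set Plane) (V : X → Set (ℤ × ℤ)) : Prop where
  subset_max : ∀ x, V x ⊆ maxStencil h θ X x
  stability : ∀ x, ∀ e ∈ V x, ∀ f ∈ maxStencil h θ X x, IsParent e f → f ∈ V x
  visibility : ∀ x, cone (V x) = cone (maxStencil h θ X x)

/-- The candidates for refinement at `x`: the vectors of the maximal stencil which are not in
`V x`, but whose two parents are. -/
def candidates (h θ : ℝ) (X : Set Plane) (V : X → Set (ℤ × ℤ)) (x : X) : Set (ℤ × ℤ) :=
  {e | e ∈ maxStencil h θ X x ∧ e ∉ V x ∧ ∃ f g, AreParents e f g ∧ f ∈ V x ∧ g ∈ V x}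

/-- Membership `u ∈ Conv(V)`: the linear forms `S`, `T` (for `e ∈ V x`) and `P` (for the
candidates `e`) are nonnegative at `u` whenever they are supported in `X`, that is, whenever the
points at which `u` has to be evaluated are points `p, q, r` of `X`. -/
structure MemConv (h θ : ℝ) (X : Set Plane) (V : X → Set (ℤ × ℤ)) (u : X → ℝ) : Prop where
  segment : ∀ x, ∀ e ∈ V x, ∀ p q : X,
    (p : Plane) = x + disp h θ e → (q : Plane) = x - disp h θ e →
      0 ≤ u p - 2 * u x + u q
  triangle : ∀ x, ∀ e ∈ V x, ∀ f g, AreParents e f g → ∀ p q r : X,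
    (p : Plane) = x + disp h θ e → (q : Plane) = x - disp h θ f → (r : Plane) = x - disp h θ g →
      0 ≤ u p + u q + u r - 3 * u x
  parallelogram : ∀ x, ∀ e ∈ candidates h θ X V x, ∀ f g, AreParents e f g → ∀ p q r : X,
    (p : Plane) = x + disp h θ e → (q : Plane) = x + disp h θ f → (r : Plane) = x + disp h θ g →
      0 ≤ u p - u q - u r + u x

/-- The cone `Conv(V)` attached to `V`. -/
def ConvStencils (h θ : ℝ) (X : Set Plane) (V : X → Set (ℤ × ℤ)) : Set (X → ℝ) :=
  {u | MemConv h θ X V u}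

/-- The set of pairs `(x, e)`, `x ∈ X`, `e ∈ V x`, with which a family `V` is identified. -/
def pairs {X : Set Plane} (V : X → Set (ℤ × ℤ)) : Set (X × (ℤ × ℤ)) := {p | p.2 ∈ V p.1}

end GridConvex

namespace GridConvex

/-- The determinant of a pair of vectors of `ℤ²`. -/
def det (a b : ℤ × ℤ) : ℤ := a.1 * b.2 - a.2 * b.1

/-- The inner product of two vectors of `ℤ²`. -/
def ip (a b : ℤ × ℤ) : ℤ := a.1 * b.1 + a.2 * b.2

theorem ip_sq_add_det_sq (a b : ℤ × ℤ) : ip a b ^ 2 + det a b ^ 2 = ip a a * ip b b := by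
  simp only [ip, det]; ring

theorem ip_self_nonneg (a : ℤ × ℤ) : 0 ≤ ip a a := by
  simp only [ip]; nlinarith [mul_self_nonneg a.1, mul_self_nonneg a.2]

theorem ip_self_pos_of_det_ne_zero {a b : ℤ × ℤ} (h : det a b ≠ 0) : 0 < ip a a := by
  rcases (ip_self_nonneg a).lt_or_eq with h' | h'
  · exact h'
  · have := ip_sq_add_det_sq a b
    rw [← h', zero_mul] at this
    have : 0 < det a b ^ 2 := by positivity
    nlinarith [sq_nonneg (ip a b)]

theorem irred_iff {a : ℤ × ℤ} : Irred a ↔ IsCoprime a.1 a.2 :=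
  Int.isCoprime_iff_gcd_eq_one.symm

theorem irred_of_det {a b : ℤ × ℤ} (h : det a b = 1) : Irred a :=
  irred_iff.2 ⟨b.2, -b.1, by simp only [det] at h; linarith⟩

theorem det_comm (a b : ℤ × ℤ) : det a b = -det b a := by simp only [det]; ring

theorem irred_of_det' {a b : ℤ × ℤ} (h : det b a = 1) : Irred a :=
  irred_iff.2 ⟨-b.2, b.1, by simp only [det] at h; linarith⟩

theorem Irred.ip_self_pos {a : ℤ × ℤ} (h : Irred a) : 0 < ip a a := by
  obtain ⟨u, v, huv⟩ := irred_iff.1 h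
  refine ip_self_pos_of_det_ne_zero (b := (-v, u)) ?_
  simp only [det]
  intro h0; linarith

theorem Irred.eq_or_eq_neg {a b : ℤ × ℤ} (ha : Irred a) (hb : Irred b) (h : det a b = 0) :
    b = a ∨ b = -a := by
  obtain ⟨u, v, huv⟩ := irred_iff.1 ha
  simp only [det] at h
  have h1 : b.1 = (u * b.1 + v * b.2) * a.1 := by linear_combination (-b.1) * huv - v * h
  have h2 : b.2 = (u * b.1 + v * b.2) * a.2 := by linear_combination (-b.2) * huv + u * h
  have hu : IsUnit (u * b.1 + v * b.2) :=
    (irred_iff.1 hb).isUnit_of_dvd' ⟨_, h1⟩ ⟨_, h2⟩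
  rcases Int.isUnit_iff.1 hu with h' | h' <;> rw [h'] at h1 h2
  · exact Or.inl (Prod.ext (by linarith) (by linarith))
  · exact Or.inr (Prod.ext (by rw [Prod.fst_neg]; linarith) (by rw [Prod.snd_neg]; linarith))

theorem Irred.eq_of_ip_pos {a b : ℤ × ℤ} (ha : Irred a) (hb : Irred b) (h : det a b = 0)
    (hp : 0 < ip a b) : b = a := by
  rcases ha.eq_or_eq_neg hb h with rfl | rfl
  · rfl
  · have := ip_self_nonneg a
    simp only [ip, Prod.fst_neg, Prod.snd_neg] at hp this
    linarith

theorem areParents_iff {e f g : ℤ × ℤ} :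
    AreParents e f g ↔ det f g = 1 ∧ 0 ≤ ip f g ∧ e = f + g := by
  simp only [AreParents, IsDirectAcuteBasis, det, ip, eq_comm (a := e), and_assoc]

namespace AreParents

variable {e f g : ℤ × ℤ}

theorem det_eq_one (h : AreParents e f g) : det f g = 1 := (areParents_iff.1 h).1

theorem ip_nonneg (h : AreParents e f g) : 0 ≤ ip f g := (areParents_iff.1 h).2.1

theorem eq_add (h : AreParents e f g) : e = f + g := (areParents_iff.1 h).2.2

theorem det_left (h : AreParents e f g) : det f e = 1 := by
  have := h.det_eq_one
  rw [h.eq_add]; simp only [det, Prod.fst_add, Prod.snd_add] at *; linarith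

theorem det_right (h : AreParents e f g) : det e g = 1 := by
  have := h.det_eq_one
  rw [h.eq_add]; simp only [det, Prod.fst_add, Prod.snd_add] at *; linarith

theorem irred (h : AreParents e f g) : Irred e := irred_of_det h.det_right

theorem irred_left (h : AreParents e f g) : Irred f := irred_of_det h.det_eq_one

theorem irred_right (h : AreParents e f g) : Irred g := irred_of_det' h.det_eq_one

theorem ip_left_pos (h : AreParents e f g) : 0 < ip f e := by
  have h1 := h.irred_left.ip_self_pos
  have h2 := h.ip_nonneg
  rw [h.eq_add]; simp only [ip, Prod.fst_add, Prod.snd_add] at *; linarith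

theorem ip_right_pos (h : AreParents e f g) : 0 < ip g e := by
  have h1 := h.irred_right.ip_self_pos
  have h2 := h.ip_nonneg
  rw [h.eq_add]; simp only [ip, Prod.fst_add, Prod.snd_add] at *; linarith

theorem ip_add (h : AreParents e f g) : ip f e + ip g e = ip e e := by
  rw [h.eq_add]; simp only [ip, Prod.fst_add, Prod.snd_add]; ring

theorem ip_self_left_lt (h : AreParents e f g) : ip f f < ip e e := by
  have h1 := h.irred_right.ip_self_pos
  have h2 := h.ip_nonneg
  rw [h.eq_add]; simp only [ip, Prod.fst_add, Prod.snd_add] at *; linarith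

theorem ip_self_right_lt (h : AreParents e f g) : ip g g < ip e e := by
  have h1 := h.irred_left.ip_self_pos
  have h2 := h.ip_nonneg
  rw [h.eq_add]; simp only [ip, Prod.fst_add, Prod.snd_add] at *; linarith

theorem unique {f' g' : ℤ × ℤ} (h : AreParents e f g) (h' : AreParents e f' g') :
    f' = f ∧ g' = g := by
  have key : det f f' * ip e e = ip f' e - ip f e := by
    have h1 := h.det_left
    have h2 := h'.det_left
    have : det f f' * ip e e = det f e * ip f' e - det f' e * ip f e := by
      simp only [det, ip]; ring
    rw [this, h1, h2]; ring
  have h1 := h.ip_left_pos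
  have h2 := h.ip_right_pos
  have h3 := h.ip_add
  have h4 := h'.ip_left_pos
  have h5 := h'.ip_right_pos
  have h6 := h'.ip_add
  have h7 : det f f' < 1 := by by_contra hc; push Not at hc; nlinarith
  have h8 : -1 < det f f' := by by_contra hc; push Not at hc; nlinarith
  have hf : f' = f := by
    rcases h.irred_left.eq_or_eq_neg h'.irred_left (by omega) with h0 | h0
    · exact h0
    · have h1 := h.det_left
      have h2 := h'.det_left
      rw [h0] at h2
      simp only [det, Prod.fst_neg, Prod.snd_neg] at h1 h2
      linarith
  refine ⟨hf, ?_⟩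
  have a1 := h.eq_add
  have a2 := h'.eq_add
  rw [hf] at a2
  exact add_left_cancel (a2.symm.trans a1)

theorem swap (h : AreParents e f g) : AreParents e.swap g.swap f.swap := by
  obtain ⟨h1, h2, h3⟩ := areParents_iff.1 h
  refine areParents_iff.2 ⟨?_, ?_, ?_⟩
  · simp only [det, Prod.fst_swap, Prod.snd_swap] at *; linarith
  · simp only [ip, Prod.fst_swap, Prod.snd_swap] at *; linarith
  · rw [h3]; ext <;> simp [add_comm]

/-- The parent of `g` on the side of `e` lies in the triangle `0, e, g`. -/
theorem det_left_mem {g₁ g₂ : ℤ × ℤ} (h : AreParents g g₁ g₂) (hd : 0 < det e g)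
    (hi : 0 ≤ ip e g) (hn : ip e e ≤ ip g g) : 0 ≤ det e g₁ ∧ det e g₁ < det e g := by
  have key : det e g₁ * ip g g = det e g * ip g₁ g - ip e g := by
    have : det e g₁ * ip g g = det e g * ip g₁ g - det g₁ g * ip e g := by
      simp only [det, ip]; ring
    rw [this, h.det_left]; ring
  have h1 := h.ip_left_pos
  have h2 := h.ip_right_pos
  have h3 := h.ip_add
  have h4 : ip e g < ip g g := by
    have := ip_sq_add_det_sq e g
    by_contra hc
    push Not at hc
    nlinarith
  constructor
  · by_contra hc; push Not at hc; nlinarith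
  · by_contra hc; push Not at hc; nlinarith

/-- The right parent of `e` lies in the triangle `0, e, g`. -/
theorem det_right_mem {e₁ e₂ : ℤ × ℤ} (h : AreParents e e₁ e₂) (hd : 0 < det e g)
    (hi : 0 ≤ ip e g) (hn : ip g g ≤ ip e e) : 0 ≤ det e₂ g ∧ det e₂ g < det e g := by
  have key : det e₂ g * ip e e = det e g * ip e₂ e - ip e g := by
    have : det e₂ g * ip e e = det e g * ip e₂ e - det e e₂ * ip e g := by
      simp only [det, ip]; ring
    rw [this, h.det_right]; ring
  have h1 := h.ip_left_pos
  have h2 := h.ip_right_pos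
  have h3 := h.ip_add
  have h4 : ip e g < ip e e := by
    have := ip_sq_add_det_sq e g
    by_contra hc
    push Not at hc
    nlinarith
  constructor
  · by_contra hc; push Not at hc; nlinarith
  · by_contra hc; push Not at hc; nlinarith

end AreParents

theorem Irred.exists_areParents {e : ℤ × ℤ} (he : Irred e) (h1 : 1 < ip e e) :
    ∃ f g, AreParents e f g := by
  obtain ⟨u, v, huv⟩ := irred_iff.1 he
  set t₀ : ℤ := ip (v, -u) e with ht₀
  set k : ℤ := t₀ / ip e e
  set f : ℤ × ℤ := (v - k * e.1, -u - k * e.2) with hf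
  have hd : det f e = 1 := by simp only [det, hf]; linear_combination huv
  have ht : ip f e = t₀ % ip e e := by
    rw [Int.emod_def]; simp only [hf, ht₀, ip, k]; ring
  have h2 := Int.emod_nonneg t₀ (b := ip e e) (by omega)
  have h3 := Int.emod_lt_of_pos t₀ (b := ip e e) (by omega)
  rw [← ht] at h2 h3
  have h4 := ip_sq_add_det_sq f e
  rw [hd] at h4
  have h5 : 0 < ip f e := by
    rcases h2.lt_or_eq with h | h
    · exact h
    · rw [← h] at h4
      have : ip f f * ip e e = 1 := by linarith
      rcases lt_or_ge (ip f f) 1 with h6 | h6 <;> nlinarith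
  refine ⟨f, e - f, areParents_iff.2 ⟨?_, ?_, by abel⟩⟩
  · simp only [det, Prod.fst_sub, Prod.snd_sub] at *; linarith
  · have h6 : ip f (e - f) = ip f e - ip f f := by
      simp only [ip, Prod.fst_sub, Prod.snd_sub]; ring
    rw [h6]
    by_contra hc
    push Not at hc
    nlinarith [mul_nonneg (show 0 ≤ ip f e - 1 by omega) (show 0 ≤ ip e e - 1 - ip f e by omega)]

/-- Sets of irreducible vectors which contain all irreducible vectors of the triangles spanned by
the origin and two of their elements. -/
structure IsStar (M : Set (ℤ × ℤ)) : Prop where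
  irred : ∀ e ∈ M, Irred e
  mem : ∀ a ∈ M, ∀ b ∈ M, ∀ (α β n : ℤ) (z : ℤ × ℤ), 0 ≤ α → 0 ≤ β → 0 < n → α + β ≤ n →
    n * z.1 = α * a.1 + β * b.1 → n * z.2 = α * a.2 + β * b.2 → Irred z → z ∈ M

/-- Sets stable under parents that lie in `M`. -/
def IsStable (M V : Set (ℤ × ℤ)) : Prop := ∀ e ∈ V, ∀ f ∈ M, IsParent e f → f ∈ V

theorem IsStar.swap {M : Set (ℤ × ℤ)} (hM : IsStar M) : IsStar (Prod.swap ⁻¹' M) where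
  irred e he := by
    have := hM.irred _ he
    simpa [Irred, Int.gcd_comm] using this
  mem a ha b hb α β n z h1 h2 h3 h4 h5 h6 hz :=
    hM.mem _ ha _ hb α β n _ h1 h2 h3 h4 h6 h5 (by simpa [Irred, Int.gcd_comm] using hz)

theorem IsStable.swap {M V : Set (ℤ × ℤ)} (hV : IsStable M V) :
    IsStable (Prod.swap ⁻¹' M) (Prod.swap ⁻¹' V) := by
  rintro e he f hf ⟨g, h⟩
  refine hV _ he _ hf ⟨g.swap, ?_⟩
  rcases h with h | h
  · exact Or.inr h.swap
  · exact Or.inl h.swap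

section Descent

variable {M V : Set (ℤ × ℤ)} {e : ℤ × ℤ}

theorem IsStable.descent (hM : IsStar M) (hVM : V ⊆ M) (hV : IsStable M V) (heM : e ∈ M)
    (heV : e ∉ V) (l : ℤ × ℤ →+ ℤ) (hle : 0 < l e) (m : ℕ) (g : ℤ × ℤ) (hm : ip g g < m)
    (hg : g ∈ V) (hd : 0 < det e g) (hi : 0 < ip e g) (hl : 0 < l g) :
    ∃ g ∈ V, 0 < det e g ∧ 0 < ip e g ∧ 0 < l g ∧ ip g g < ip e e := by
  induction m generalizing g with
  | zero => have := ip_self_nonneg g; push_cast at hm; omega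
  | succ m ih =>
    by_cases hn : ip g g < ip e e
    · exact ⟨g, hg, hd, hi, hl, hn⟩
    push Not at hn
    have hg1 : 1 < ip g g := by
      have := (hM.irred _ (hVM hg)).ip_self_pos
      by_contra hc
      have h1 : ip g g = 1 := by omega
      have h3 := (hM.irred _ heM).ip_self_pos
      have h2 := ip_sq_add_det_sq e g
      have h4 : ip e e = 1 := by omega
      rw [h1, h4] at h2
      nlinarith
    obtain ⟨g₁, g₂, hp⟩ := (hM.irred _ (hVM hg)).exists_areParents hg1
    obtain ⟨hb0, hb1⟩ := hp.det_left_mem hd hi.le hn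
    have hone := hp.det_left
    have e1 : det e g * g₁.1 = 1 * e.1 + det e g₁ * g.1 := by
      rw [← hone]; simp only [det]; ring
    have e2 : det e g * g₁.2 = 1 * e.2 + det e g₁ * g.2 := by
      rw [← hone]; simp only [det]; ring
    have hg₁M : g₁ ∈ M := hM.mem _ heM _ (hVM hg) 1 (det e g₁) (det e g) g₁ (by omega) hb0 hd
      (by omega) e1 e2 hp.irred_left
    have hg₁V : g₁ ∈ V := hV _ hg _ hg₁M ⟨g₂, Or.inl hp⟩
    have hi1 : 0 < ip e g₁ := by
      have : det e g * ip e g₁ = ip e e + det e g₁ * ip e g := by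
        simp only [ip]; linear_combination e.1 * e1 + e.2 * e2
      have h3 := (hM.irred _ heM).ip_self_pos
      by_contra hc
      push Not at hc
      nlinarith [mul_nonneg hb0 hi.le]
    have hl1 : 0 < l g₁ := by
      have h5 : det e g • g₁ = e + det e g₁ • g := by
        ext
        · simp only [Prod.smul_fst, Prod.fst_add, smul_eq_mul]; linarith
        · simp only [Prod.smul_snd, Prod.snd_add, smul_eq_mul]; linarith
      have h6 := congrArg l h5
      rw [map_add, map_zsmul, map_zsmul, smul_eq_mul, smul_eq_mul] at h6
      by_contra hc
      push Not at hc
      nlinarith [mul_nonneg hb0 hl.le]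
    have hd1 : 0 < det e g₁ := by
      rcases hb0.lt_or_eq with h | h
      · exact h
      · exact absurd ((hM.irred _ heM).eq_of_ip_pos (hM.irred _ hg₁M) h.symm hi1 ▸ hg₁V) heV
    exact ih g₁ (by have := hp.ip_self_left_lt; push_cast at hm; omega) hg₁V hd1 hi1 hl1

/-- The inner product with `e` as an additive map. -/
def ipHom (e : ℤ × ℤ) : ℤ × ℤ →+ ℤ where
  toFun := ip e
  map_zero' := by simp [ip]
  map_add' a b := by simp only [ip, Prod.fst_add, Prod.snd_add]; ring

/-- The determinant with `e` as an additive map. -/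
def detHom (e : ℤ × ℤ) : ℤ × ℤ →+ ℤ where
  toFun a := det a e
  map_zero' := by simp [det]
  map_add' a b := by simp only [det, Prod.fst_add, Prod.snd_add]; ring

theorem IsStable.right_parent_mem (hM : IsStar M) (hVM : V ⊆ M) (hV : IsStable M V) (heM : e ∈ M)
    (heV : e ∉ V) {g : ℤ × ℤ} (hg : g ∈ V) (hd : 0 < det e g) (hi : 0 < ip e g) :
    ∃ e₁ e₂, AreParents e e₁ e₂ ∧ e₂ ∈ M := by
  obtain ⟨g, hg, hd, hi, -, hn⟩ := hV.descent hM hVM heM heV (ipHom e)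
    (hM.irred _ heM).ip_self_pos (ip g g + 1).toNat g (by omega) hg hd hi hi
  have h1 := (hM.irred _ (hVM hg)).ip_self_pos
  obtain ⟨e₁, e₂, hp⟩ := (hM.irred _ heM).exists_areParents (by omega)
  refine ⟨e₁, e₂, hp, ?_⟩
  obtain ⟨hb0, hb1⟩ := hp.det_right_mem hd hi.le hn.le
  have hone := hp.det_right
  refine hM.mem _ heM _ (hVM hg) (det e₂ g) 1 (det e g) e₂ hb0 (by omega) hd (by omega)
    ?_ ?_ hp.irred_right
  · rw [← hone]; simp only [det]; ring
  · rw [← hone]; simp only [det]; ring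

theorem IsStable.left_parent_mem (hM : IsStar M) (hVM : V ⊆ M) (hV : IsStable M V) (heM : e ∈ M)
    (heV : e ∉ V) {f : ℤ × ℤ} (hf : f ∈ V) (hd : 0 < det f e) (hi : 0 < ip e f) :
    ∃ e₁ e₂, AreParents e e₁ e₂ ∧ e₁ ∈ M := by
  obtain ⟨e₁, e₂, h1, h2⟩ := hV.swap.right_parent_mem (e := e.swap) (g := f.swap) hM.swap
    (Set.preimage_mono hVM) (by simpa using heM) (by simpa using heV) (by simpa using hf)
    (by simp only [det, Prod.fst_swap, Prod.snd_swap] at *; linarith)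
    (by simp only [ip, Prod.fst_swap, Prod.snd_swap] at *; linarith)
  exact ⟨e₂.swap, e₁.swap, by simpa using h1.swap, h2⟩

/-- A vector of the maximal stencil which is missing in a stable stencil, although it lies on the
positive side of no line that has the stencil on its negative side, has both parents. -/
theorem IsStable.parents_mem_of_pos (hM : IsStar M) (hVM : V ⊆ M) (hV : IsStable M V)
    (heM : e ∈ M) (heV : e ∉ V) (hc : ∀ l : ℤ × ℤ →+ ℤ, 0 < l e → ∃ f ∈ V, 0 < l f)
    {g : ℤ × ℤ} (hg : g ∈ V) (hd : 0 < det e g) (hi : 0 < ip e g) :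
    ∃ e₁ e₂, AreParents e e₁ e₂ ∧ e₁ ∈ M ∧ e₂ ∈ M := by
  obtain ⟨e₁, e₂, hp, h2⟩ := hV.right_parent_mem hM hVM heM heV hg hd hi
  refine ⟨e₁, e₂, hp, ?_, h2⟩
  obtain ⟨f, hf, ha⟩ := hc (detHom e₂) (by show 0 < det e e₂; rw [hp.det_right]; norm_num)
  replace ha : 0 < det f e₂ := ha
  have hone := hp.det_eq_one
  have hsum : det f e = det f e₂ - det e₁ f := by
    rw [hp.eq_add]; simp only [det, Prod.fst_add, Prod.snd_add]; ring
  have hf1 : f.1 = det f e₂ * e₁.1 + det e₁ f * e₂.1 := by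
    rw [← one_mul f.1, ← hone]; simp only [det]; ring
  have hf2 : f.2 = det f e₂ * e₁.2 + det e₁ f * e₂.2 := by
    rw [← one_mul f.2, ← hone]; simp only [det]; ring
  have hif : ip e f = det f e₂ * ip e₁ e + det e₁ f * ip e₂ e := by
    simp only [ip]; rw [hf1, hf2]; ring
  have hL := hp.ip_left_pos
  have hR := hp.ip_right_pos
  rcases lt_or_ge (det e₁ f) 0 with hb | hb
  · refine hM.mem _ (hVM hf) _ heM 1 (-det e₁ f) (det f e₂ - det e₁ f) e₁ (by omega) (by omega)
      (by omega) (by omega) ?_ ?_ hp.irred_left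
    · rw [hp.eq_add, Prod.fst_add]; linear_combination -hf1
    · rw [hp.eq_add, Prod.snd_add]; linear_combination -hf2
  have hif' : 0 < ip e f := by rw [hif]; positivity
  rcases lt_trichotomy (det e₁ f) (det f e₂) with hab | hab | hab
  · obtain ⟨e₁', e₂', hp', h'⟩ := hV.left_parent_mem hM hVM heM heV hf (by omega) hif'
    rwa [(hp.unique hp').1] at h'
  · have : f = e := (hM.irred _ heM).eq_of_ip_pos (hM.irred _ (hVM hf))
      (by rw [det_comm]; omega) hif'
    exact absurd (this ▸ hf) heV
  · exfalso
    obtain ⟨g, hg, hd, hi, hl, hn⟩ := hV.descent hM hVM heM heV (detHom e₂)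
      (by show 0 < det e e₂; rw [hp.det_right]; norm_num) (ip f f + 1).toNat f (by omega) hf
      (by rw [det_comm]; omega) hif' ha
    replace hl : 0 < det g e₂ := hl
    have hone := hp.det_right
    have hf1 : g.1 = det g e₂ * e.1 + det e g * e₂.1 := by
      rw [← one_mul g.1, ← hone]; simp only [det]; ring
    have hf2 : g.2 = det g e₂ * e.2 + det e g * e₂.2 := by
      rw [← one_mul g.2, ← hone]; simp only [det]; ring
    have hgg : ip g g = det g e₂ ^ 2 * ip e e + 2 * det g e₂ * det e g * ip e₂ e
        + det e g ^ 2 * ip e₂ e₂ := by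
      generalize det g e₂ = p at *
      generalize det e g = q at *
      simp only [ip]; rw [hf1, hf2]; ring
    have h1 : 0 ≤ 2 * det g e₂ * det e g * ip e₂ e := by positivity
    have h2 : 0 ≤ det e g ^ 2 * ip e₂ e₂ := mul_nonneg (sq_nonneg _) (ip_self_nonneg _)
    have h3 : ip e e ≤ det g e₂ ^ 2 * ip e e :=
      le_mul_of_one_le_left (ip_self_nonneg _) (by nlinarith)
    linarith

theorem IsStable.parents_mem (hM : IsStar M) (hVM : V ⊆ M) (hV : IsStable M V)
    (heM : e ∈ M) (heV : e ∉ V) (hc : ∀ l : ℤ × ℤ →+ ℤ, 0 < l e → ∃ f ∈ V, 0 < l f) :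
    ∃ e₁ e₂, AreParents e e₁ e₂ ∧ e₁ ∈ M ∧ e₂ ∈ M := by
  obtain ⟨g, hg, hi⟩ := hc (ipHom e) (hM.irred _ heM).ip_self_pos
  replace hi : 0 < ip e g := hi
  rcases lt_trichotomy (det e g) 0 with hd | hd | hd
  · obtain ⟨e₁, e₂, h1, h2, h3⟩ := hV.swap.parents_mem_of_pos (e := e.swap) (g := g.swap) hM.swap
      (Set.preimage_mono hVM) (by simpa using heM) (by simpa using heV)
      (fun l hl => by
        let s : ℤ × ℤ →+ ℤ × ℤ := (AddEquiv.prodComm : ℤ × ℤ ≃+ ℤ × ℤ).toAddMonoidHom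
        obtain ⟨f, hf, hlf⟩ := hc (l.comp s) hl
        exact ⟨f.swap, by simpa using hf, hlf⟩)
      (by simpa using hg)
      (by simp only [det, Prod.fst_swap, Prod.snd_swap] at *; linarith)
      (by simp only [ip, Prod.fst_swap, Prod.snd_swap] at *; linarith)
    exact ⟨e₂.swap, e₁.swap, by simpa using h1.swap, h3, h2⟩
  · exact absurd ((hM.irred _ heM).eq_of_ip_pos (hM.irred _ (hVM hg)) hd hi ▸ hg) heV
  · exact hV.parents_mem_of_pos hM hVM heM heV hc hg hd hi

end Descent

/-- Sets of lattice points which contain the lattice points of the triangles spanned by their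
elements, with a function that is convex on these triangles. -/
def IsLatticeConvex (Z : Set (ℤ × ℤ)) (v : ℤ × ℤ → ℝ) : Prop :=
  ∀ a ∈ Z, ∀ b ∈ Z, ∀ c ∈ Z, ∀ α β γ n : ℤ, 0 ≤ α → 0 ≤ β → 0 ≤ γ → 0 < n → α + β + γ = n →
    ∀ z : ℤ × ℤ, n * z.1 = α * a.1 + β * b.1 + γ * c.1 → n * z.2 = α * a.2 + β * b.2 + γ * c.2 →
      z ∈ Z ∧ (n : ℝ) * v z ≤ α * v a + β * v b + γ * v c

/-- The maximal stencil at `x`, in lattice coordinates. -/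
def maxAt (Z : Set (ℤ × ℤ)) (x : ℤ × ℤ) : Set (ℤ × ℤ) := {e | Irred e ∧ x + e ∈ Z}

/-- The elements of the maximal stencil for which the parallelogram form is negative or is not
supported in `Z`. -/
def negAt (Z : Set (ℤ × ℤ)) (v : ℤ × ℤ → ℝ) (x : ℤ × ℤ) : Set (ℤ × ℤ) :=
  {e | e ∈ maxAt Z x ∧ ∀ f g, AreParents e f g → x + f ∈ Z → x + g ∈ Z →
    v (x + e) + v x < v (x + f) + v (x + g)}

namespace IsLatticeConvex

variable {Z : Set (ℤ × ℤ)} {v : ℤ × ℤ → ℝ}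

theorem isStar (hZ : IsLatticeConvex Z v) {x : ℤ × ℤ} (hx : x ∈ Z) : IsStar (maxAt Z x) where
  irred e he := he.1
  mem a ha b hb α β n z h1 h2 h3 h4 h5 h6 hz := by
    refine ⟨hz, (hZ _ ha.2 _ hb.2 _ hx α β (n - α - β) n h1 h2 (by omega) h3 (by ring) _ ?_ ?_).1⟩
    · simp only [Prod.fst_add]; linear_combination h5
    · simp only [Prod.snd_add]; linear_combination h6

theorem neg_of_neg_child (hZ : IsLatticeConvex Z v) {x f f₁ f₂ g e : ℤ × ℤ} {k : ℤ} (hk : 0 ≤ k)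
    (hx : x ∈ Z) (h1 : x + f₁ ∈ Z) (h2 : x + f₂ ∈ Z) (he : x + e ∈ Z) (hf : f = f₁ + f₂)
    (hg : g = k • f + f₂) (hefg : e = f + g)
    (hneg : x + g ∈ Z → v (x + e) + v x < v (x + f) + v (x + g)) :
    v (x + f) + v x < v (x + f₁) + v (x + f₂) := by
  obtain ⟨hgZ, hvg⟩ := hZ _ h2 _ he _ hx 1 k 0 (k + 1) (by omega) hk le_rfl (by omega) (by ring)
    (x + g)
    (by rw [hefg, hg]
        simp only [Prod.fst_add, Prod.smul_fst, smul_eq_mul]; ring)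
    (by rw [hefg, hg]
        simp only [Prod.snd_add, Prod.smul_snd, smul_eq_mul]; ring)
  obtain ⟨-, hvf⟩ := hZ _ h1 _ he _ hx 1 1 k (k + 2) (by omega) (by omega) hk (by omega) (by ring)
    (x + f)
    (by rw [hefg, hg, hf]
        simp only [Prod.fst_add, Prod.smul_fst, smul_eq_mul]; ring)
    (by rw [hefg, hg, hf]
        simp only [Prod.snd_add, Prod.smul_snd, smul_eq_mul]; ring)
  have hk' : (0 : ℝ) < k + 1 := by exact_mod_cast (by omega : 0 < k + 1)
  have := mul_lt_mul_of_pos_left (hneg hgZ) hk'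
  push_cast at hvg hvf
  linarith

theorem stable_negAt (hZ : IsLatticeConvex Z v) {x : ℤ × ℤ} (hx : x ∈ Z) :
    IsStable (maxAt Z x) (negAt Z v x) := by
  rintro e ⟨heM, heN⟩ f hf ⟨g, h⟩
  refine ⟨hf, fun f₁ f₂ hp h1 h2 => ?_⟩
  have hff := hp.irred.ip_self_pos
  have hadd := hp.ip_add
  rcases h with h | h
  · have hone := h.det_eq_one
    have hone' := hp.det_right
    refine hZ.neg_of_neg_child (k := det g f₂) ?_ hx h1 h2 heM.2 hp.eq_add (g := g) ?_ h.eq_add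
      fun hg => heN f g h hf.2 hg
    · have h3 : ip f g = det g f₂ * ip f f + det f g * ip f₂ f := by
        have : det f f₂ * ip f g = det g f₂ * ip f f + det f g * ip f₂ f := by
          simp only [det, ip]; ring
        rw [← this, hone', one_mul]
      have h4 := h.ip_nonneg
      have h5 := hp.ip_left_pos
      rw [hone] at h3
      by_contra hc
      push Not at hc
      nlinarith
    · ext
      · simp only [Prod.fst_add, Prod.smul_fst, smul_eq_mul]
        simp only [det] at *; linear_combination (-g.1) * hone' + f₂.1 * hone
      · simp only [Prod.snd_add, Prod.smul_snd, smul_eq_mul]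
        simp only [det] at *; linear_combination (-g.2) * hone' + f₂.2 * hone
  · have hone := h.det_eq_one
    have hone' := hp.det_left
    rw [add_comm (v (x + f₁))]
    refine hZ.neg_of_neg_child (k := det f₁ g) ?_ hx h2 h1 heM.2
      (by rw [hp.eq_add, add_comm]) (g := g) ?_ (by rw [h.eq_add, add_comm])
      fun hg => by rw [add_comm (v (x + f))]; exact heN g f h hg hf.2
    · have h3 : ip g f = det f₁ g * ip f f + det g f * ip f₁ f := by
        have : det f₁ f * ip g f = det f₁ g * ip f f + det g f * ip f₁ f := by
          simp only [det, ip]; ring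
        rw [← this, hone', one_mul]
      have h4 := h.ip_nonneg
      have h5 := hp.ip_right_pos
      rw [hone] at h3
      by_contra hc
      push Not at hc
      nlinarith
    · ext
      · simp only [Prod.fst_add, Prod.smul_fst, smul_eq_mul]
        simp only [det] at *; linear_combination (-g.1) * hone' + f₁.1 * hone
      · simp only [Prod.snd_add, Prod.smul_snd, smul_eq_mul]
        simp only [det] at *; linear_combination (-g.2) * hone' + f₁.2 * hone

end IsLatticeConvex

/-- The `ℓ¹` norm on `ℤ²`. -/
def l1 (e : ℤ × ℤ) : ℤ := |e.1| + |e.2|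

theorem AreParents.same_quadrant {e f g : ℤ × ℤ} (h : AreParents e f g) :
    0 ≤ f.1 * g.1 ∧ 0 ≤ f.2 * g.2 := by
  have h1 := h.det_eq_one
  have h2 := h.ip_nonneg
  obtain ⟨a, b⟩ := f
  obtain ⟨c, d⟩ := g
  simp only [det, ip] at *
  have h3 : (a * c) * (b * d) = (a * d) * (b * c) := by ring
  constructor
  · by_contra hc
    push Not at hc
    have h4 : 1 ≤ b * d := by omega
    have h5 : (a * d) * (b * c) < 0 := by rw [← h3]; nlinarith
    have h6 : b * c = a * d - 1 := by omega
    rw [h6] at h5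
    generalize a * d = t at h5
    rcases lt_or_ge t 1 with h | h <;> nlinarith
  · by_contra hc
    push Not at hc
    have h4 : 1 ≤ a * c := by omega
    have h5 : (a * d) * (b * c) < 0 := by rw [← h3]; nlinarith
    have h6 : b * c = a * d - 1 := by omega
    rw [h6] at h5
    generalize a * d = t at h5
    rcases lt_or_ge t 1 with h | h <;> nlinarith

theorem Irred.l1_pos {e : ℤ × ℤ} (h : Irred e) : 0 < l1 e := by
  have := h.ip_self_pos
  by_contra hc
  simp only [l1, ip] at *
  have h1 : e.1 = 0 := abs_eq_zero.1 (by have := abs_nonneg e.1; have := abs_nonneg e.2; omega)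
  have h2 : e.2 = 0 := abs_eq_zero.1 (by have := abs_nonneg e.1; have := abs_nonneg e.2; omega)
  simp [h1, h2] at this

theorem abs_combination {a b p q : ℤ} (hab : 0 ≤ a * b) (hpq : 0 ≤ p * q) :
    |a * p + b * q| = |a| * |p| + |b| * |q| := by
  rw [← abs_mul, ← abs_mul]
  refine abs_add_eq_add_abs_iff _ _ |>.2 (mul_nonneg_iff.1 ?_)
  have := mul_nonneg hab hpq
  linarith

theorem AreParents.l1_combination {e f g : ℤ × ℤ} (h : AreParents e f g) {a b : ℤ}
    (hab : 0 ≤ a * b) : l1 (a • f + b • g) = |a| * l1 f + |b| * l1 g := by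
  obtain ⟨h1, h2⟩ := h.same_quadrant
  simp only [l1, Prod.fst_add, Prod.snd_add, Prod.smul_fst, Prod.smul_snd, smul_eq_mul]
  rw [abs_combination hab h1, abs_combination hab h2]
  ring

namespace IsLatticeConvex

variable {Z : Set (ℤ × ℤ)} {v : ℤ × ℤ → ℝ}

theorem not_mixed_signs (hZ : IsLatticeConvex Z v) {x e f g p q : ℤ × ℤ} (hx : x ∈ Z)
    (he : e ∈ negAt Z v x) (hp : AreParents e f g) (hpZ : p ∈ Z) (hqZ : q ∈ Z)
    (hs : p + q = x + x + e) (hle : v p + v q ≤ v (x + e) + v x)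
    (ha : 1 ≤ det (p - q) g) (hb : det f (p - q) ≤ -1) : False := by
  have hone := hp.det_eq_one
  have hexp : p - q = det (p - q) g • f + det f (p - q) • g := by
    ext
    · simp only [Prod.fst_add, Prod.smul_fst, smul_eq_mul]
      rw [← one_mul (p - q).1, ← hone]; simp only [det]; ring
    · simp only [Prod.snd_add, Prod.smul_snd, smul_eq_mul]
      rw [← one_mul (p - q).2, ← hone]; simp only [det]; ring
  generalize det (p - q) g = a at *
  generalize det f (p - q) = b at *
  have hpe : p = a • f + b • g + q := by rw [← hexp]; abel
  rw [hp.eq_add] at hs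
  have s1 := congrArg Prod.fst hs
  have s2 := congrArg Prod.snd hs
  have d1 := congrArg Prod.fst hexp
  have d2 := congrArg Prod.snd hexp
  simp only [Prod.fst_add, Prod.snd_add, Prod.fst_sub, Prod.snd_sub, Prod.smul_fst, Prod.smul_snd,
    smul_eq_mul] at s1 s2 d1 d2
  obtain ⟨hf, hvf⟩ := hZ _ he.1.2 _ hx _ hpZ (-b - 1) (a - 1) 2 (a - b) (by omega) (by omega)
    (by omega) (by omega) (by ring) (x + f)
    (by rw [hp.eq_add]; simp only [Prod.fst_add]; linear_combination -s1 - d1)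
    (by rw [hp.eq_add]; simp only [Prod.snd_add]; linear_combination -s2 - d2)
  obtain ⟨hg, hvg⟩ := hZ _ hx _ he.1.2 _ hqZ (-b - 1) (a - 1) 2 (a - b) (by omega) (by omega)
    (by omega) (by omega) (by ring) (x + g)
    (by rw [hp.eq_add]; simp only [Prod.fst_add]; linear_combination -s1 + d1)
    (by rw [hp.eq_add]; simp only [Prod.snd_add]; linear_combination -s2 + d2)
  have hneg := he.2 f g hp hf hg
  have hpos : (0 : ℝ) < a - b := by exact_mod_cast (by omega : 0 < a - b)
  have := mul_lt_mul_of_pos_left hneg hpos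
  push_cast at hvf hvg
  linarith

/-- Among the pairs `(x, e)` with a given midpoint and a negative parallelogram form, the `ℓ¹` norm
determines `e` up to sign. -/
theorem eq_or_eq_neg_of_l1_eq (hZ : IsLatticeConvex Z v) {x e x' e' f g : ℤ × ℤ} (hx : x ∈ Z)
    (hx' : x' ∈ Z) (he : x + e ∈ Z) (he' : e' ∈ negAt Z v x') (hp : AreParents e' f g)
    (hs : x + x + e = x' + x' + e') (hle : v (x + e) + v x ≤ v (x' + e') + v x')
    (hl : l1 e = l1 e') : e = e' ∨ e = -e' := by
  have hone := hp.det_eq_one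
  have hodd : e = e' + ((x' - x) + (x' - x)) := by
    have : e = (x + x + e) - x - x := by abel
    rw [this, hs]; abel
  have ha : det e g = 1 + 2 * det (x' - x) g := by
    rw [hodd, ← hp.det_right]
    simp only [det, Prod.fst_add, Prod.snd_add]
    ring
  have hb : det f e = 1 + 2 * det f (x' - x) := by
    rw [hodd, ← hp.det_left]
    simp only [det, Prod.fst_add, Prod.snd_add]
    ring
  have c1 : ¬ (1 ≤ det e g ∧ det f e ≤ -1) := fun h =>
    hZ.not_mixed_signs hx' he' hp he hx (by rw [← hs]; abel) hle (by simpa using h.1)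
      (by simpa using h.2)
  have c2 : ¬ (det e g ≤ -1 ∧ 1 ≤ det f e) := fun h =>
    hZ.not_mixed_signs hx' he' hp hx he (by rw [← hs]; abel) (by rwa [add_comm (v x)])
      (by rw [sub_add_cancel_left]; simp only [det, Prod.fst_neg, Prod.snd_neg] at *; linarith)
      (by rw [sub_add_cancel_left]; simp only [det, Prod.fst_neg, Prod.snd_neg] at *; linarith)
  have hexp : e = det e g • f + det f e • g := by
    ext
    · simp only [Prod.fst_add, Prod.smul_fst, smul_eq_mul]
      rw [← one_mul e.1, ← hone]; simp only [det]; ring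
    · simp only [Prod.snd_add, Prod.smul_snd, smul_eq_mul]
      rw [← one_mul e.2, ← hone]; simp only [det]; ring
  have hab : 0 ≤ det e g * det f e := by
    rcases le_or_gt 0 (det e g) with h | h
    · exact mul_nonneg h (by omega)
    · exact mul_nonneg_of_nonpos_of_nonpos h.le (by omega)
  have hl' : l1 e' = l1 f + l1 g := by
    have := hp.l1_combination (a := 1) (b := 1) (by norm_num)
    simpa [← hp.eq_add] using this
  rw [hl', hexp, hp.l1_combination hab] at hl
  have hf := hp.irred_left.l1_pos
  have hg := hp.irred_right.l1_pos
  have ha1 : 1 ≤ |det e g| := Int.one_le_abs (by omega)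
  have hb1 : 1 ≤ |det f e| := Int.one_le_abs (by omega)
  have ha2 : |det e g| = 1 := by
    by_contra hc
    have : 2 ≤ |det e g| := by omega
    nlinarith
  have hb2 : |det f e| = 1 := by
    by_contra hc
    have : 2 ≤ |det f e| := by omega
    nlinarith
  rcases (abs_eq (by norm_num)).1 ha2 with h1 | h1 <;> rcases (abs_eq (by norm_num)).1 hb2 with h2 | h2
  · left; rw [hexp, h1, h2, hp.eq_add]; simp
  · omega
  · omega
  · right; rw [hexp, h1, h2, hp.eq_add]; simp; abel

end IsLatticeConvex

/-- A pair of edges of a lattice set at a point `t` which is between their other end points for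
the linear form `l`, such that the fourth vertex of the parallelogram is missing. -/
def IsCorner (Z : Set (ℤ × ℤ)) (l : ℤ × ℤ →+ ℝ) (t a b : ℤ × ℤ) : Prop :=
  t ∈ Z ∧ t + a ∈ Z ∧ t + b ∈ Z ∧ t + a + b ∉ Z ∧ 0 < l a ∧ l b < 0

/-- A lattice set on a line, with an edge `a` at a point `t`. -/
def IsLine (Z : Set (ℤ × ℤ)) (l : ℤ × ℤ →+ ℝ) (t a : ℤ × ℤ) : Prop :=
  t ∈ Z ∧ t + a ∈ Z ∧ Irred a ∧ 0 < l a ∧ ∀ z ∈ Z, det a (z - t) = 0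

theorem exists_injective_linear_form : ∃ l : ℤ × ℤ →+ ℝ, Function.Injective l := by
  refine ⟨⟨⟨fun z => z.1 + √2 * z.2, by simp⟩, fun a b => by simp; ring⟩, ?_⟩
  rw [injective_iff_map_eq_zero]
  rintro ⟨a, b⟩ h
  simp only [AddMonoidHom.coe_mk, ZeroHom.coe_mk] at h
  by_cases hb : b = 0
  · subst hb; simpa using h
  · have := (irrational_sqrt_two.mul_intCast hb).intCast_add a
    rw [h] at this
    exact absurd this not_irrational_zero

section

variable {Z : Set (ℤ × ℤ)} {v : ℤ × ℤ → ℝ} {l : ℤ × ℤ →+ ℝ}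

theorem IsLatticeConvex.add_mem (hZ : IsLatticeConvex Z v) {t a b w : ℤ × ℤ} {α β : ℤ}
    (ht : t ∈ Z) (ha : t + a ∈ Z) (hb : t + b ∈ Z) (hw : t + w ∈ Z) (hα : 1 ≤ α) (hβ : 1 ≤ β)
    (h : w = α • a + β • b) : t + a + b ∈ Z := by
  rcases le_total α β with hab | hab
  · refine (hZ _ hw _ ha _ ht 1 (β - α) (α - 1) β (by omega) (by omega) (by omega) (by omega)
      (by ring) _ ?_ ?_).1 <;> rw [h]
    · simp only [Prod.fst_add, Prod.smul_fst, smul_eq_mul]; ring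
    · simp only [Prod.snd_add, Prod.smul_snd, smul_eq_mul]; ring
  · refine (hZ _ hw _ hb _ ht 1 (α - β) (β - 1) α (by omega) (by omega) (by omega) (by omega)
      (by ring) _ ?_ ?_).1 <;> rw [h]
    · simp only [Prod.fst_add, Prod.smul_fst, smul_eq_mul]; ring
    · simp only [Prod.snd_add, Prod.smul_snd, smul_eq_mul]; ring

theorem expand_in_basis {a b : ℤ × ℤ} (h : det a b = 1) (w : ℤ × ℤ) :
    w = det w b • a + det a w • b := by
  ext
  · simp only [Prod.fst_add, Prod.smul_fst, smul_eq_mul]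
    rw [← one_mul w.1, ← h]; simp only [det]; ring
  · simp only [Prod.snd_add, Prod.smul_snd, smul_eq_mul]
    rw [← one_mul w.2, ← h]; simp only [det]; ring

theorem map_expand_in_basis {a b : ℤ × ℤ} (h : det a b = 1) (l : ℤ × ℤ →+ ℝ) (w : ℤ × ℤ) :
    l w = det w b * l a + det a w * l b := by
  conv_lhs => rw [expand_in_basis h w]
  rw [map_add, map_zsmul, map_zsmul, zsmul_eq_mul, zsmul_eq_mul]

theorem IsCorner.det_le (hZ : IsLatticeConvex Z v) {t a b a' b' : ℤ × ℤ}
    (h : IsCorner Z l t a b) (h' : IsCorner Z l t a' b') (hd : det a b = 1) :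
    det a a' ≤ 0 ∧ det b' b ≤ 0 := by
  obtain ⟨h1, h2, h3, h4, h5, h6⟩ := h
  obtain ⟨-, h2', h3', -, h5', h6'⟩ := h'
  constructor
  · by_contra hc
    push Not at hc
    refine h4 (hZ.add_mem h1 h2 h3 h2' (α := det a' b) (β := det a a') ?_ hc
      (expand_in_basis hd a'))
    by_contra hα
    have e := map_expand_in_basis hd l a'
    have r1 : (det a' b : ℝ) ≤ 0 := by exact_mod_cast (by omega : det a' b ≤ 0)
    have r2 : (0 : ℝ) < det a a' := by exact_mod_cast hc
    nlinarith
  · by_contra hc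
    push Not at hc
    refine h4 (hZ.add_mem h1 h2 h3 h3' (α := det b' b) (β := det a b') hc ?_
      (expand_in_basis hd b'))
    by_contra hα
    have e := map_expand_in_basis hd l b'
    have r1 : (det a b' : ℝ) ≤ 0 := by exact_mod_cast (by omega : det a b' ≤ 0)
    have r2 : (0 : ℝ) < det b' b := by exact_mod_cast hc
    nlinarith

theorem eq_of_det_eq_zero_of_pos {a a' : ℤ × ℤ} (ha : Irred a) (ha' : Irred a')
    (h : det a a' = 0) (hl : 0 < l a) (hl' : 0 < l a') : a' = a := by
  rcases ha.eq_or_eq_neg ha' h with h | h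
  · exact h
  · rw [h, map_neg] at hl'; linarith

theorem IsCorner.unique_of_det_eq_one (hZ : IsLatticeConvex Z v) {t a b a' b' : ℤ × ℤ}
    (h : IsCorner Z l t a b) (h' : IsCorner Z l t a' b') (hd : det a b = 1) (hd' : det a' b' = 1) :
    a' = a ∧ b' = b := by
  obtain ⟨h1, h2⟩ := h.det_le hZ h' hd
  obtain ⟨h3, h4⟩ := h'.det_le hZ h hd'
  rw [det_comm] at h3 h4
  constructor
  · exact eq_of_det_eq_zero_of_pos (l := l) (irred_of_det hd) (irred_of_det hd') (by omega)
      h.2.2.2.2.1 h'.2.2.2.2.1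
  · refine eq_of_det_eq_zero_of_pos (l := -l) (irred_of_det' hd) (irred_of_det' hd')
      (by rw [det_comm]; omega) ?_ ?_
    · simpa using h.2.2.2.2.2
    · simpa using h'.2.2.2.2.2

theorem IsCorner.reverse {t a b : ℤ × ℤ} (h : IsCorner Z l t a b) : IsCorner Z (-l) t b a :=
  ⟨h.1, h.2.2.1, h.2.1, by rw [add_right_comm]; exact h.2.2.2.1, by simpa using h.2.2.2.2.2,
    by simpa using h.2.2.2.2.1⟩

theorem IsCorner.unique_of_det_eq_neg_one (hZ : IsLatticeConvex Z v) {t a b a' b' : ℤ × ℤ}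
    (h : IsCorner Z l t a b) (h' : IsCorner Z l t a' b') (hd : det a b = -1)
    (hd' : det a' b' = -1) : a' = a ∧ b' = b :=
  (h.reverse.unique_of_det_eq_one hZ h'.reverse (by rw [det_comm]; omega)
    (by rw [det_comm]; omega)).symm

theorem IsLine.unique {t a a' : ℤ × ℤ} (h : IsLine Z l t a) (h' : IsLine Z l t a') : a' = a :=
  eq_of_det_eq_zero_of_pos h.2.2.1 h'.2.2.1 (by simpa using h.2.2.2.2 _ h'.2.1) h.2.2.2.1
    h'.2.2.2.1

/-- A lattice triangle with a primitive edge has a lattice point next to that edge. -/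
theorem IsLatticeConvex.exists_det_eq (hZ : IsLatticeConvex Z v) {x d z : ℤ × ℤ} (hd : Irred d)
    (hx : x ∈ Z) (hxd : x + d ∈ Z) (hz : z ∈ Z) (h : det d (z - x) ≠ 0) :
    ∃ σ : ℤ, (σ = 1 ∨ σ = -1) ∧ ∃ p ∈ Z, det d (p - x) = σ := by
  set w := z - x with hw
  obtain ⟨σ, hσ, hn⟩ : ∃ σ : ℤ, (σ = 1 ∨ σ = -1) ∧ 0 < σ * det d w := by
    rcases lt_or_gt_of_ne h with h | h
    · exact ⟨-1, Or.inr rfl, by omega⟩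
    · exact ⟨1, Or.inl rfl, by omega⟩
  refine ⟨σ, hσ, ?_⟩
  have hσ2 : σ * σ = 1 := by rcases hσ with rfl | rfl <;> norm_num
  obtain ⟨r, s, hrs⟩ := irred_iff.1 hd
  set n := σ * det d w with hnd
  set q₀ : ℤ × ℤ := (-σ * s, σ * r) with hq₀
  set β₀ := σ * det q₀ w with hβ₀
  obtain ⟨m, hm⟩ : ∃ m, m = β₀ / n := ⟨_, rfl⟩
  set q : ℤ × ℤ := q₀ - m • d with hq
  have hdq : det d q = σ := by
    simp only [det, hq, hq₀, Prod.fst_sub, Prod.snd_sub, Prod.smul_fst, Prod.smul_snd, smul_eq_mul]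
    linear_combination σ * hrs
  have hβ : σ * det q w = β₀ % n := by
    have : σ * det q w = β₀ - n * m := by
      rw [hβ₀, hnd]
      simp only [det, hq, Prod.fst_sub, Prod.snd_sub, Prod.smul_fst, Prod.smul_snd, smul_eq_mul]
      ring
    rw [this, Int.emod_def, hm]
  have hβ0 : 0 ≤ σ * det q w := hβ ▸ Int.emod_nonneg _ hn.ne'
  have hβ1 : σ * det q w < n := hβ ▸ Int.emod_lt_of_pos _ hn
  refine ⟨x + q, (hZ _ hz _ hxd _ hx 1 (σ * det q w) (n - 1 - σ * det q w) n (by omega) hβ0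
    (by omega) hn (by ring) _ ?_ ?_).1, by simpa using hdq⟩
  · have e1 : z.1 = x.1 + w.1 := by simp [hw]
    have e2 : n * q.1 = w.1 + σ * det q w * d.1 := by
      have : n * q.1 = σ * (det d q * w.1 + det q w * d.1) := by
        rw [hnd]; simp only [det]; ring
      rw [this, hdq]; linear_combination w.1 * hσ2
    rw [e1]; simp only [Prod.fst_add]; linear_combination e2
  · have e1 : z.2 = x.2 + w.2 := by simp [hw]
    have e2 : n * q.2 = w.2 + σ * det q w * d.2 := by
      have : n * q.2 = σ * (det d q * w.2 + det q w * d.2) := by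
        rw [hnd]; simp only [det]; ring
      rw [this, hdq]; linear_combination w.2 * hσ2
    rw [e1]; simp only [Prod.snd_add]; linear_combination e2

/-- A lattice segment whose midpoint is not a lattice point contains a primitive segment with the
same midpoint. -/
theorem IsLatticeConvex.exists_primitive (hZ : IsLatticeConvex Z v) {x d : ℤ × ℤ}
    (hx : x ∈ Z) (hxd : x + d ∈ Z) (hd : ¬ (2 ∣ d.1 ∧ 2 ∣ d.2)) :
    ∃ x' d', ∃ j : ℕ, x' ∈ Z ∧ x' + d' ∈ Z ∧ Irred d' ∧ x' + x' + d' = x + x + d ∧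
      d = (2 * j + 1) • d' := by
  have hg : 0 < Int.gcd d.1 d.2 := by
    rw [Int.gcd_pos_iff]
    by_contra hc
    push Not at hc
    exact hd (by simp [hc])
  obtain ⟨p, q, hpq, h1, h2⟩ := Int.exists_gcd_one hg
  obtain ⟨j, hj | hj⟩ := Nat.even_or_odd' (Int.gcd d.1 d.2)
  · refine absurd ⟨?_, ?_⟩ hd
    · rw [h1, hj]; push_cast; exact ⟨p * j, by ring⟩
    · rw [h2, hj]; push_cast; exact ⟨q * j, by ring⟩
  · rw [hj] at h1 h2
    push_cast at h1 h2
    refine ⟨x + (j * p, j * q), (p, q), j, ?_, ?_, hpq, ?_, ?_⟩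
    · refine (hZ _ hx _ hxd _ hx (j + 1) j 0 (2 * j + 1) (by omega) (by omega) le_rfl (by omega)
        (by ring) _ ?_ ?_).1
      · simp only [Prod.fst_add, h1]; ring
      · simp only [Prod.snd_add, h2]; ring
    · refine (hZ _ hx _ hxd _ hx j (j + 1) 0 (2 * j + 1) (by omega) (by omega) le_rfl (by omega)
        (by ring) _ ?_ ?_).1
      · simp only [Prod.fst_add, h1]; ring
      · simp only [Prod.snd_add, h2]; ring
    · ext
      · simp only [Prod.fst_add, h1]; ring
      · simp only [Prod.snd_add, h2]; ring
    · ext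
      · rw [Prod.smul_fst, nsmul_eq_mul, h1]; push_cast; ring
      · rw [Prod.smul_snd, nsmul_eq_mul, h2]; push_cast; ring

/-- The doubled midpoints of primitive edges. -/
def midpoints (Z : Set (ℤ × ℤ)) : Set (ℤ × ℤ) :=
  {s | ∃ x ∈ Z, ∃ e, Irred e ∧ x + e ∈ Z ∧ s = x + x + e}

theorem exists_corner_or_line (hZ : IsLatticeConvex Z v) (hfin : Z.Finite)
    (hl : Function.Injective l) {s : ℤ × ℤ} (hs : s ∈ midpoints Z) :
    (∃ t a b, IsCorner Z l t a b ∧ (det a b = 1 ∨ det a b = -1) ∧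
      (s = t + t + a ∨ s = t + t + b ∨ s = t + t + a + b)) ∨
    ∃ t a, IsLine Z l t a ∧ s = t + t + a := by
  have hl0 : ∀ w, w ≠ 0 → l w ≠ 0 := fun w hw h => hw (hl (by rw [h, map_zero]))
  have hodd : ∀ x d : ℤ × ℤ, s = x + x + d → ¬ (2 ∣ d.1 ∧ 2 ∣ d.2) := by
    rintro x d hd ⟨h1, h2⟩
    obtain ⟨y, -, e, he, -, hs⟩ := hs
    rw [hd] at hs
    have e1 := congrArg Prod.fst hs
    have e2 := congrArg Prod.snd hs
    simp only [Prod.fst_add, Prod.snd_add] at e1 e2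
    have : (2 : ℤ) ∣ Int.gcd e.1 e.2 := Int.dvd_coe_gcd (by omega) (by omega)
    rw [he] at this
    norm_num at this
  let P : Set (ℤ × ℤ) := {x | x ∈ Z ∧ s - x ∈ Z ∧ 0 < l (s - x - x)}
  have hP : P.Nonempty := by
    obtain ⟨x, hx, e, he, hxe, rfl⟩ := hs
    have he0 : e ≠ 0 := by rintro rfl; simp [Irred] at he
    rcases lt_or_gt_of_ne (hl0 e he0) with h | h
    · refine ⟨x + e, hxe, by convert hx using 1; abel, ?_⟩
      rw [show x + x + e - (x + e) - (x + e) = -e by abel, map_neg]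
      linarith
    · exact ⟨x, hx, by convert hxe using 1; abel, by rwa [show x + x + e - x - x = e by abel]⟩
  obtain ⟨x, ⟨hx, hy, hpos⟩, hmin⟩ := Set.exists_min_image P (fun x => l (s - x - x))
    (hfin.subset fun _ h => h.1) hP
  set d := s - x - x with hd
  have hxd : x + d ∈ Z := by rw [hd]; convert hy using 1; abel
  have hsd : s = x + x + d := by rw [hd]; abel
  have hirr : Irred d := by
    obtain ⟨x', d', j, h1, h2, h3, h4, h5⟩ := hZ.exists_primitive hx hxd (hodd x d hsd)
    have hld : l d = (2 * j + 1) * l d' := by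
      rw [h5, map_nsmul, nsmul_eq_mul]; push_cast; rfl
    have e1 : s - x' - x' = d' := by rw [hsd, ← h4]; abel
    have hpos' : 0 < l d' := by
      by_contra hc
      push Not at hc
      have : (2 * (j : ℝ) + 1) * l d' ≤ 0 := mul_nonpos_of_nonneg_of_nonpos (by positivity) hc
      linarith
    have := hmin x' ⟨h1, by convert h2 using 1; rw [← e1]; abel, by rwa [e1]⟩
    simp only [e1, hld] at this
    have hj : j = 0 := by
      by_contra hj
      have : (1 : ℝ) ≤ j := by exact_mod_cast Nat.one_le_iff_ne_zero.2 hj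
      nlinarith
    rw [h5, hj]; simpa using h3
  by_cases hline : ∀ z ∈ Z, det d (z - x) = 0
  · exact Or.inr ⟨x, d, ⟨hx, hxd, hirr, hpos, hline⟩, hsd⟩
  push Not at hline
  obtain ⟨z, hz, hdz⟩ := hline
  obtain ⟨σ, hσ, hrow⟩ := hZ.exists_det_eq hirr hx hxd hz hdz
  have hσ0 : σ ≠ 0 := by rcases hσ with rfl | rfl <;> norm_num
  left
  by_cases hA : ∃ p ∈ Z, det d (p - x) = σ ∧ 0 < l (p - x) ∧ l (p - x) < l d
  · obtain ⟨p, hp, hdp, h1, h2⟩ := hA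
    refine ⟨p, x + d - p, x - p, ⟨hp, by simpa using hxd, by simpa using hx, ?_, ?_, ?_⟩, ?_, ?_⟩
    · intro h
      rw [show p + (x + d - p) + (x - p) = s - p by rw [hsd]; abel] at h
      have hne : s - p - p ≠ 0 := by
        intro h0
        refine hodd p 0 ?_ (by simp)
        rw [add_zero, ← sub_eq_zero, ← h0]; abel
      have e1 : s - p - p = d - (p - x) - (p - x) := by rw [hsd]; abel
      have e2 : l (s - p - p) = l d - l (p - x) - l (p - x) := by rw [e1, map_sub, map_sub]
      rcases lt_or_gt_of_ne (hl0 _ hne) with h0 | h0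
      · have e3 : s - (s - p) - (s - p) = -(s - p - p) := by abel
        have := hmin (s - p) ⟨h, by simpa using hp, by rw [e3, map_neg]; linarith⟩
        simp only [e3, map_neg] at this
        linarith
      · have := hmin p ⟨hp, h, h0⟩
        linarith
    · rw [show x + d - p = d - (p - x) by abel, map_sub]; linarith
    · rw [← neg_sub, map_neg]; linarith
    · have : det (x + d - p) (x - p) = -det d (p - x) := by
        simp only [det, Prod.fst_add, Prod.snd_add, Prod.fst_sub, Prod.snd_sub]; ring
      rw [this, hdp]; omega
    · right; right; rw [hsd]; abel
  push Not at hA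
  have hside : ∀ p ∈ Z, det d (p - x) = σ → l (p - x) < 0 ∨ l d < l (p - x) := by
    intro p hp hdp
    have h1 : p - x ≠ 0 := by intro h; rw [h] at hdp; simp [det] at hdp; omega
    have h2 : p - x ≠ d := by
      intro h; rw [h] at hdp; simp only [det, mul_comm, sub_self] at hdp; omega
    rcases lt_or_gt_of_ne (hl0 _ h1) with h | h
    · exact Or.inl h
    · exact Or.inr (lt_of_le_of_ne (hA p hp hdp h) fun h => h2 (hl h).symm)
  by_cases hB : ∃ p ∈ Z, det d (p - x) = σ ∧ l d < l (p - x)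
  · obtain ⟨p, ⟨hp, hdp, h1⟩, hpmin⟩ := Set.exists_min_image
      {p | p ∈ Z ∧ det d (p - x) = σ ∧ l d < l (p - x)} (fun p => l (p - x))
      (hfin.subset fun _ h => h.1) hB
    refine ⟨x + d, p - x - d, -d, ⟨hxd, ?_, by simpa using hx, ?_, ?_, ?_⟩, ?_, ?_⟩
    · convert hp using 1; abel
    · intro h
      rw [show x + d + (p - x - d) + -d = p - d by abel] at h
      have e1 : det d (p - d - x) = σ := by
        rw [← hdp]; simp only [det, Prod.fst_sub, Prod.snd_sub]; ring
      have e2 : l (p - d - x) = l (p - x) - l d := by rw [← map_sub]; congr 1; abel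
      rcases hside _ h e1 with h0 | h0
      · linarith
      · have := hpmin _ ⟨h, e1, h0⟩
        linarith
    · rw [map_sub]; linarith
    · rw [map_neg]; linarith
    · have : det (p - x - d) (-d) = det d (p - x) := by
        simp only [det, Prod.fst_neg, Prod.snd_neg, Prod.fst_sub, Prod.snd_sub]; ring
      rw [this, hdp]; exact hσ
    · right; left; rw [hsd]; abel
  · push Not at hB
    obtain ⟨p, ⟨hp, hdp⟩, hpmax⟩ := Set.exists_max_image
      {p | p ∈ Z ∧ det d (p - x) = σ} (fun p => l (p - x)) (hfin.subset fun _ h => h.1) hrow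
    have hside' : ∀ p ∈ Z, det d (p - x) = σ → l (p - x) < 0 := fun p hp hdp =>
      (hside p hp hdp).resolve_right (not_lt.2 (hB p hp hdp))
    refine ⟨x, d, p - x, ⟨hx, hxd, by simpa using hp, ?_, hpos, hside' p hp hdp⟩,
      by rw [hdp]; exact hσ, Or.inl hsd⟩
    intro h
    rw [show x + d + (p - x) = p + d by abel] at h
    have e1 : det d (p + d - x) = σ := by
      rw [← hdp]; simp only [det, Prod.fst_sub, Prod.snd_sub, Prod.fst_add, Prod.snd_add]; ring
    have e2 : l (p + d - x) = l (p - x) + l d := by rw [← map_add]; congr 1; abel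
    have := hpmax _ ⟨h, e1⟩
    linarith

theorem ncard_midpoints_le (hZ : IsLatticeConvex Z v) (hfin : Z.Finite) :
    (midpoints Z).Finite ∧ (midpoints Z).ncard ≤ 7 * Z.ncard := by
  obtain ⟨l, hl⟩ := exists_injective_linear_form
  have h1 : ∀ t, ∃ c : (ℤ × ℤ) × (ℤ × ℤ), ∀ a b, IsCorner Z l t a b → det a b = 1 → (a, b) = c := by
    intro t
    by_cases h : ∃ a b, IsCorner Z l t a b ∧ det a b = 1
    · obtain ⟨a, b, h, hd⟩ := h
      refine ⟨(a, b), fun a' b' h' hd' => ?_⟩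
      obtain ⟨rfl, rfl⟩ := h.unique_of_det_eq_one hZ h' hd hd'
      rfl
    · exact ⟨0, fun a b h' hd' => absurd ⟨a, b, h', hd'⟩ h⟩
  have h2 : ∀ t, ∃ c : (ℤ × ℤ) × (ℤ × ℤ), ∀ a b, IsCorner Z l t a b → det a b = -1 →
      (a, b) = c := by
    intro t
    by_cases h : ∃ a b, IsCorner Z l t a b ∧ det a b = -1
    · obtain ⟨a, b, h, hd⟩ := h
      refine ⟨(a, b), fun a' b' h' hd' => ?_⟩
      obtain ⟨rfl, rfl⟩ := h.unique_of_det_eq_neg_one hZ h' hd hd'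
      rfl
    · exact ⟨0, fun a b h' hd' => absurd ⟨a, b, h', hd'⟩ h⟩
  have h3 : ∀ t, ∃ c : ℤ × ℤ, ∀ a, IsLine Z l t a → a = c := by
    intro t
    by_cases h : ∃ a, IsLine Z l t a
    · obtain ⟨a, h⟩ := h
      exact ⟨a, fun a' h' => h.unique h'⟩
    · exact ⟨0, fun a h' => absurd ⟨a, h'⟩ h⟩
  choose c₁ hc₁ using h1
  choose c₂ hc₂ using h2
  choose c₃ hc₃ using h3
  let F : Fin 7 → ℤ × ℤ → ℤ × ℤ := fun i t =>
    ![t + t + (c₁ t).1, t + t + (c₁ t).2, t + t + (c₁ t).1 + (c₁ t).2,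
      t + t + (c₂ t).1, t + t + (c₂ t).2, t + t + (c₂ t).1 + (c₂ t).2, t + t + c₃ t] i
  have hsub : midpoints Z ⊆ (fun p : Fin 7 × (ℤ × ℤ) => F p.1 p.2) '' (Set.univ ×ˢ Z) := by
    intro s hs
    rcases exists_corner_or_line hZ hfin hl hs with ⟨t, a, b, hc, hd, h⟩ | ⟨t, a, h, hs⟩
    · rcases hd with hd | hd
      · have e := hc₁ t a b hc hd
        have ea : (c₁ t).1 = a := by rw [← e]
        have eb : (c₁ t).2 = b := by rw [← e]
        rcases h with rfl | rfl | rfl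
        · exact ⟨(0, t), ⟨trivial, hc.1⟩, by simp [F, ea]⟩
        · exact ⟨(1, t), ⟨trivial, hc.1⟩, by simp [F, eb]⟩
        · exact ⟨(2, t), ⟨trivial, hc.1⟩, by simp [F, ea, eb]⟩
      · have e := hc₂ t a b hc hd
        have ea : (c₂ t).1 = a := by rw [← e]
        have eb : (c₂ t).2 = b := by rw [← e]
        rcases h with rfl | rfl | rfl
        · exact ⟨(3, t), ⟨trivial, hc.1⟩, by simp [F, ea]⟩
        · exact ⟨(4, t), ⟨trivial, hc.1⟩, by simp [F, eb]⟩
        · exact ⟨(5, t), ⟨trivial, hc.1⟩, by simp [F, ea, eb]⟩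
    · exact ⟨(6, t), ⟨trivial, h.1⟩, by simp [F, ← hc₃ t a h, hs]⟩
  have hf : ((Set.univ : Set (Fin 7)) ×ˢ Z).Finite := Set.finite_univ.prod hfin
  refine ⟨(hf.image _).subset hsub, (Set.ncard_le_ncard hsub (hf.image _)).trans
    ((Set.ncard_image_le hf).trans ?_)⟩
  rw [Set.ncard_prod, Set.ncard_univ]
  simp

end

variable {Z : Set (ℤ × ℤ)} {v : ℤ × ℤ → ℝ}

/-- The pairs `(x, e)` with `e` in the stencil `negAt Z v x`. -/
def negPairs (Z : Set (ℤ × ℤ)) (v : ℤ × ℤ → ℝ) : Set ((ℤ × ℤ) × (ℤ × ℤ)) :=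
  {p | p.1 ∈ Z ∧ p.2 ∈ negAt Z v p.1}

theorem mem_units_of_ip_le_one {e : ℤ × ℤ} (h : ip e e ≤ 1) (he : Irred e) :
    e ∈ ({(1, 0), (-1, 0), (0, 1), (0, -1)} : Set (ℤ × ℤ)) := by
  have h0 := he.ip_self_pos
  obtain ⟨a, b⟩ := e
  simp only [ip] at *
  have h1 : a ≤ 1 := by nlinarith [mul_self_nonneg b]
  have h2 : -1 ≤ a := by nlinarith [mul_self_nonneg b]
  have h3 : b ≤ 1 := by nlinarith [mul_self_nonneg a]
  have h4 : -1 ≤ b := by nlinarith [mul_self_nonneg a]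
  interval_cases a <;> interval_cases b <;> simp_all

theorem ncard_negPairs_le (hZ : IsLatticeConvex Z v) (hfin : Z.Finite) {K : ℕ}
    (hK : ∀ x ∈ Z, ∀ e, x + e ∈ Z → l1 e ≤ K) :
    (negPairs Z v).Finite ∧ (negPairs Z v).ncard ≤ (4 + 14 * (K + 1)) * Z.ncard := by
  obtain ⟨l, hl⟩ := exists_injective_linear_form
  obtain ⟨hmf, hmc⟩ := ncard_midpoints_le hZ hfin
  set Q : Set ((ℤ × ℤ) × (ℤ × ℤ)) := {p | p ∈ negPairs Z v ∧ 1 < ip p.2 p.2} with hQ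
  set U : Set (ℤ × ℤ) := {(1, 0), (-1, 0), (0, 1), (0, -1)} with hU
  have hUf : U.Finite := by simp [hU]
  have hUc : U.ncard ≤ 4 := by
    rw [hU, ← Finset.coe_singleton, ← Finset.coe_insert, ← Finset.coe_insert,
      ← Finset.coe_insert, Set.ncard_coe_finset]
    exact Finset.card_le_four
  set T : Set ((ℤ × ℤ) × (ℕ × Prop)) := midpoints Z ×ˢ (Set.Iic K ×ˢ Set.univ) with hT
  have hTf : T.Finite := hmf.prod ((Set.finite_Iic K).prod Set.finite_univ)
  have hTc : T.ncard ≤ 7 * Z.ncard * ((K + 1) * 2) := by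
    rw [hT, Set.ncard_prod, Set.ncard_prod, Set.ncard_univ]
    have : (Set.Iic K).ncard = K + 1 := by
      rw [← Finset.coe_Iic, Set.ncard_coe_finset, Nat.card_Iic]
    rw [this]
    simp only [Nat.card_eq_fintype_card, Fintype.card_prop]
    exact Nat.mul_le_mul_right _ hmc
  let F : (ℤ × ℤ) × (ℤ × ℤ) → (ℤ × ℤ) × (ℕ × Prop) := fun p =>
    (p.1 + p.1 + p.2, ((l1 p.2).toNat, 0 < l p.2))
  have hFm : Set.MapsTo F Q T := by
    rintro ⟨x, e⟩ ⟨⟨hx, he⟩, -⟩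
    refine ⟨⟨x, hx, e, he.1.1, he.1.2, rfl⟩, ?_, trivial⟩
    have := hK x hx e he.1.2
    simp only [Set.mem_Iic, F]
    omega
  have key : ∀ x e x' e' : ℤ × ℤ, (x, e) ∈ Q → (x', e') ∈ Q → F (x, e) = F (x', e') →
      v (x + e) + v x ≤ v (x' + e') + v x' → (x, e) = (x', e') := by
    rintro x e x' e' ⟨⟨hx, he⟩, -⟩ ⟨⟨hx', he'⟩, h1⟩ hF hle
    dsimp only at hx he hx' he' h1
    simp only [F, Prod.mk.injEq] at hF
    obtain ⟨hs, hl1, hpos⟩ := hF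
    have p1 := he.1.1.l1_pos
    have p2 := he'.1.1.l1_pos
    obtain ⟨f, g, hp⟩ := he'.1.1.exists_areParents h1
    rcases hZ.eq_or_eq_neg_of_l1_eq hx hx' he.1.2 he' hp hs hle (by omega)
      with h | h
    · subst h
      have hs' := add_right_cancel hs
      rw [Prod.mk.injEq]
      refine ⟨?_, rfl⟩
      have s1 := congrArg Prod.fst hs'
      have s2 := congrArg Prod.snd hs'
      simp only [Prod.fst_add, Prod.snd_add] at s1 s2
      exact Prod.ext (by omega) (by omega)
    · exfalso
      rw [h, map_neg] at hpos
      have h0 : l e' ≠ 0 := by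
        intro h0
        have : e' = 0 := hl (by rw [h0, map_zero])
        rw [this] at p2
        simp [l1] at p2
      simp only [neg_pos, eq_iff_iff] at hpos
      rcases lt_or_gt_of_ne h0 with h | h
      · exact absurd (hpos.1 h) (not_lt.2 h.le)
      · exact absurd (hpos.2 h) (not_lt.2 h.le)
  have hFi : Set.InjOn F Q := by
    rintro ⟨x, e⟩ h ⟨x', e'⟩ h' hF
    rcases le_total (v (x + e) + v x) (v (x' + e') + v x') with hle | hle
    · exact key x e x' e' h h' hF hle
    · exact (key x' e' x e h' h hF.symm hle).symm
  have hQf : Q.Finite := Set.Finite.of_injOn hFm hFi hTf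
  have hQc : Q.ncard ≤ T.ncard := Set.ncard_le_ncard_of_injOn F hFm hFi hTf
  have hsub : negPairs Z v ⊆ Z ×ˢ U ∪ Q := by
    rintro ⟨x, e⟩ h
    by_cases h1 : 1 < ip e e
    · exact Or.inr ⟨h, h1⟩
    · exact Or.inl ⟨h.1, mem_units_of_ip_le_one (not_lt.1 h1) h.2.1.1⟩
  have hf : (Z ×ˢ U ∪ Q).Finite := (hfin.prod hUf).union hQf
  refine ⟨hf.subset hsub, ?_⟩
  calc (negPairs Z v).ncard ≤ (Z ×ˢ U ∪ Q).ncard := Set.ncard_le_ncard hsub hf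
    _ ≤ (Z ×ˢ U).ncard + Q.ncard := Set.ncard_union_le _ _
    _ ≤ Z.ncard * 4 + 7 * Z.ncard * ((K + 1) * 2) := by
      rw [Set.ncard_prod]
      exact Nat.add_le_add (Nat.mul_le_mul_left _ hUc) (hQc.trans hTc)
    _ = (4 + 14 * (K + 1)) * Z.ncard := by ring

/-- The conditions on the stencil at `x` of a family of stencils whose cone contains `v`. -/
structure IsGood (Z : Set (ℤ × ℤ)) (v : ℤ × ℤ → ℝ) (x : ℤ × ℤ) (V : Set (ℤ × ℤ)) : Prop where
  subset_max : V ⊆ maxAt Z x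
  stable : IsStable (maxAt Z x) V
  visible : cone V = cone (maxAt Z x)
  closed : ∀ e ∈ maxAt Z x, e ∉ V → ∀ f g, AreParents e f g → f ∈ V → g ∈ V →
    v (x + f) + v (x + g) ≤ v (x + e) + v x

/-- The smallest stencil at `x` of the families of stencils whose cone contains `v`. -/
def minAt (Z : Set (ℤ × ℤ)) (v : ℤ × ℤ → ℝ) (x : ℤ × ℤ) : Set (ℤ × ℤ) :=
  {e | ∀ V, IsGood Z v x V → e ∈ V}

theorem lat_add (a b : ℤ × ℤ) : lat (a + b) = lat a + lat b := by
  ext i; fin_cases i <;> simp [lat]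

theorem cone_eq_of_parents {M S : Set (ℤ × ℤ)} (hS : S ⊆ M)
    (h : ∀ e ∈ M, e ∉ S → ∃ f g, AreParents e f g ∧ f ∈ M ∧ g ∈ M) : cone S = cone M := by
  refine le_antisymm (Submodule.span_mono (Set.image_mono hS)) (Submodule.span_le.2 ?_)
  rintro _ ⟨e, he, rfl⟩
  induction hn : (ip e e).toNat using Nat.strong_induction_on generalizing e with
  | _ n ih =>
    by_cases heS : e ∈ S
    · exact Submodule.subset_span ⟨e, heS, rfl⟩
    · obtain ⟨f, g, hp, hf, hg⟩ := h e he heS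
      have h1 := hp.ip_self_left_lt
      have h2 := hp.ip_self_right_lt
      have h3 := ip_self_nonneg f
      have h4 := ip_self_nonneg g
      rw [hp.eq_add, lat_add]
      exact Submodule.add_mem _ (ih _ (by omega) f hf rfl) (ih _ (by omega) g hg rfl)

theorem exists_pos_of_lat_mem_cone {V : Set (ℤ × ℤ)} {e : ℤ × ℤ} (he : lat e ∈ cone V)
    (l : ℤ × ℤ →+ ℤ) (hl : 0 < l e) : ∃ f ∈ V, 0 < l f := by
  by_contra hc
  push Not at hc
  have hform : ∀ f : ℤ × ℤ, (l f : ℝ) = l (1, 0) * lat f 0 + l (0, 1) * lat f 1 := by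
    intro f
    have : f = f.1 • (1, 0) + f.2 • (0, 1) := by ext <;> simp
    have h2 : l f = f.1 * l (1, 0) + f.2 * l (0, 1) := by
      conv_lhs => rw [this]
      rw [map_add, map_zsmul, map_zsmul, smul_eq_mul, smul_eq_mul]
    rw [h2]
    simp [lat]
    ring
  have key : ∀ p ∈ cone V, (l (1, 0) : ℝ) * p 0 + l (0, 1) * p 1 ≤ 0 := by
    intro p hp
    induction hp using Submodule.span_induction with
    | mem p hp =>
      obtain ⟨f, hf, rfl⟩ := hp
      rw [← hform]
      exact_mod_cast hc f hf
    | zero => simp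
    | add p q _ _ h1 h2 =>
      simp only [PiLp.add_apply]; linarith
    | smul c p _ h =>
      have e1 : (c • p) 0 = (c : ℝ) * p 0 := rfl
      have e2 : (c • p) 1 = (c : ℝ) * p 1 := rfl
      rw [e1, e2]
      have := mul_nonpos_of_nonneg_of_nonpos c.2 h
      linarith
  have := key _ he
  rw [← hform] at this
  have h2 : l e ≤ 0 := by exact_mod_cast this
  omega

theorem isGood_negAt (hZ : IsLatticeConvex Z v) {x : ℤ × ℤ} (hx : x ∈ Z) :
    IsGood Z v x (negAt Z v x) where
  subset_max e he := he.1
  stable := hZ.stable_negAt hx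
  visible := by
    refine cone_eq_of_parents (fun e he => he.1) fun e he heN => ?_
    by_contra hc
    push Not at hc
    exact heN ⟨he, fun f g hp hf hg =>
      absurd ⟨hp.irred_right, hg⟩ (hc f g hp ⟨hp.irred_left, hf⟩)⟩
  closed e he heN f g hp _ _ := by
    by_contra hc
    refine heN ⟨he, fun f' g' hp' _ _ => ?_⟩
    obtain ⟨rfl, rfl⟩ := hp.unique hp'
    exact not_le.1 hc

theorem isGood_minAt (hZ : IsLatticeConvex Z v) {x : ℤ × ℤ} (hx : x ∈ Z) :
    IsGood Z v x (minAt Z v x) where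
  subset_max e he := (he _ (isGood_negAt hZ hx)).1
  stable e he f hf hp V hV := hV.stable e (he V hV) f hf hp
  visible := by
    refine cone_eq_of_parents (fun e he => (he _ (isGood_negAt hZ hx)).1) fun e he heN => ?_
    simp only [minAt, Set.mem_ofPred_eq, not_forall] at heN
    obtain ⟨V, hV, heV⟩ := heN
    refine hV.stable.parents_mem (hZ.isStar hx) hV.subset_max he heV fun l hl => ?_
    refine exists_pos_of_lat_mem_cone ?_ l hl
    rw [hV.visible]
    exact Submodule.subset_span ⟨e, he, rfl⟩
  closed e he heN f g hp hf hg := by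
    simp only [minAt, Set.mem_ofPred_eq, not_forall] at heN
    obtain ⟨V, hV, heV⟩ := heN
    exact hV.closed e he heV f g hp (hf V hV) (hg V hV)

/-- The point of the plane with lattice coordinates `z`. -/
noncomputable def point (h θ : ℝ) (ξ : Plane) (z : ℤ × ℤ) : Plane := h • rot θ (ξ + lat z)

/-- The lattice coordinates of the grid points. -/
def latticeSet (Ω : Set Plane) (h θ : ℝ) (ξ : Plane) : Set (ℤ × ℤ) := {z | point h θ ξ z ∈ Ω}

section

variable {Ω : Set Plane} {h θ : ℝ} {ξ : Plane}

theorem point_add (z e : ℤ × ℤ) : point h θ ξ (z + e) = point h θ ξ z + disp h θ e := by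
  ext i; fin_cases i <;> simp [point, disp, rot, lat] <;> ring

theorem disp_neg (e : ℤ × ℤ) : disp h θ (-e) = -disp h θ e := by
  ext i; fin_cases i <;> simp [disp, rot, lat] <;> ring

theorem norm_disp_sq (e : ℤ × ℤ) : ‖disp h θ e‖ ^ 2 = h ^ 2 * ip e e := by
  rw [EuclideanSpace.real_norm_sq_eq, Fin.sum_univ_two]
  simp only [disp, rot, lat, ip, PiLp.smul_apply, smul_eq_mul, Matrix.cons_val_zero,
    Matrix.cons_val_one]
  push_cast
  linear_combination (h ^ 2 * ((e.1 : ℝ) ^ 2 + (e.2 : ℝ) ^ 2)) * Real.sin_sq_add_cos_sq θ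

theorem point_injective (hh : 0 < h) : Function.Injective (point h θ ξ) := by
  intro a b hab
  have h1 : point h θ ξ (a + (b - a)) = point h θ ξ b := by rw [add_sub_cancel]
  rw [point_add, hab, add_eq_left] at h1
  have h2 := norm_disp_sq (h := h) (θ := θ) (b - a)
  rw [h1, norm_zero] at h2
  have h3 : ((ip (b - a) (b - a) : ℤ) : ℝ) = 0 := by
    have : h ^ 2 ≠ 0 := by positivity
    have h4 : h ^ 2 * ((ip (b - a) (b - a) : ℤ) : ℝ) = 0 := by rw [← h2]; norm_num
    exact (mul_eq_zero.1 h4).resolve_left this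
  have h4 : ip (b - a) (b - a) = 0 := by exact_mod_cast h3
  simp only [ip, Prod.fst_sub, Prod.snd_sub] at h4
  have h5 : b.1 - a.1 = 0 := by nlinarith
  have h6 : b.2 - a.2 = 0 := by nlinarith
  exact Prod.ext (by omega) (by omega)

theorem grid_eq_image : grid Ω h θ ξ = point h θ ξ '' latticeSet Ω h θ ξ := by
  ext p
  constructor
  · rintro ⟨hp, z, rfl⟩
    exact ⟨z, hp, rfl⟩
  · rintro ⟨z, hz, rfl⟩
    exact ⟨hz, z, rfl⟩

theorem point_mem_grid (hh : 0 < h) {z : ℤ × ℤ} :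
    point h θ ξ z ∈ grid Ω h θ ξ ↔ z ∈ latticeSet Ω h θ ξ := by
  rw [grid_eq_image, (point_injective hh).mem_set_image]

theorem ip_self_le (hΩ : IsCompact Ω) (hh : 0 < h) {x e : ℤ × ℤ} (hx : x ∈ latticeSet Ω h θ ξ)
    (hxe : x + e ∈ latticeSet Ω h θ ξ) : ((ip e e : ℤ) : ℝ) ≤ (Metric.diam Ω / h) ^ 2 := by
  have h1 := Metric.dist_le_diam_of_mem hΩ.isBounded hxe hx
  rw [point_add, dist_eq_norm, add_sub_cancel_left] at h1
  have h2 := pow_le_pow_left₀ (norm_nonneg _) h1 2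
  rw [norm_disp_sq] at h2
  rw [div_pow, le_div_iff₀ (by positivity)]
  linarith

theorem abs_le_floor (hΩ : IsCompact Ω) (hh : 0 < h) {x e : ℤ × ℤ}
    (hx : x ∈ latticeSet Ω h θ ξ) (hxe : x + e ∈ latticeSet Ω h θ ξ) :
    |e.1| ≤ ⌊Metric.diam Ω / h⌋₊ ∧ |e.2| ≤ ⌊Metric.diam Ω / h⌋₊ := by
  have h1 := ip_self_le hΩ hh hx hxe
  have hD : 0 ≤ Metric.diam Ω / h := div_nonneg Metric.diam_nonneg hh.le
  have aux : ∀ a : ℤ, a * a ≤ ip e e → |a| ≤ ⌊Metric.diam Ω / h⌋₊ := by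
    intro a ha
    have h2 : |(a : ℝ)| ≤ Metric.diam Ω / h := by
      refine abs_le_of_sq_le_sq ?_ hD
      have : ((a * a : ℤ) : ℝ) ≤ (ip e e : ℤ) := by exact_mod_cast ha
      push_cast at this
      nlinarith
    rw [Int.abs_eq_natAbs]
    have : a.natAbs ≤ ⌊Metric.diam Ω / h⌋₊ := Nat.le_floor (by rwa [Nat.cast_natAbs, Int.cast_abs])
    exact_mod_cast this
  exact ⟨aux _ (by simp only [ip]; nlinarith), aux _ (by simp only [ip]; nlinarith)⟩

theorem finite_latticeSet (hΩ : IsCompact Ω) (hh : 0 < h) : (latticeSet Ω h θ ξ).Finite := by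
  rcases (latticeSet Ω h θ ξ).eq_empty_or_nonempty with h0 | ⟨z, hz⟩
  · rw [h0]; exact Set.finite_empty
  · set k : ℤ := ((⌊Metric.diam Ω / h⌋₊ : ℕ) : ℤ)
    refine (Set.finite_Icc (z - (k, k)) (z + (k, k))).subset fun w hw => ?_
    obtain ⟨h1, h2⟩ := abs_le_floor hΩ hh hz (e := w - z) (by rwa [add_sub_cancel])
    rw [abs_le] at h1 h2
    simp only [Prod.fst_sub, Prod.snd_sub] at h1 h2
    exact ⟨⟨by simp only [Prod.fst_sub]; omega, by simp only [Prod.snd_sub]; omega⟩,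
      ⟨by simp only [Prod.fst_add]; omega, by simp only [Prod.snd_add]; omega⟩⟩

theorem isLatticeConvex_latticeSet {U : Plane → ℝ} (hU : ConvexOn ℝ Ω U) :
    IsLatticeConvex (latticeSet Ω h θ ξ) fun z => U (point h θ ξ z) := by
  intro a ha b hb c hc α β γ n hα hβ hγ hn hsum z h1 h2
  have hn' : (0 : ℝ) < n := by exact_mod_cast hn
  have hsum' : (α : ℝ) + β + γ = n := by exact_mod_cast hsum
  have h1' : (n : ℝ) * z.1 = α * a.1 + β * b.1 + γ * c.1 := by exact_mod_cast h1
  have h2' : (n : ℝ) * z.2 = α * a.2 + β * b.2 + γ * c.2 := by exact_mod_cast h2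
  let w : Fin 3 → ℝ := ![α / n, β / n, γ / n]
  let p : Fin 3 → Plane := ![point h θ ξ a, point h θ ξ b, point h θ ξ c]
  have hw0 : ∀ i ∈ Finset.univ, 0 ≤ w i := by
    intro i _
    have hα' : (0 : ℝ) ≤ α := by exact_mod_cast hα
    have hβ' : (0 : ℝ) ≤ β := by exact_mod_cast hβ
    have hγ' : (0 : ℝ) ≤ γ := by exact_mod_cast hγ
    fin_cases i <;> simp only [w] <;> exact div_nonneg (by assumption) hn'.le
  have hw1 : ∑ i, w i = 1 := by
    simp only [w, Fin.sum_univ_three, Matrix.cons_val]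
    rw [← add_div, ← add_div, hsum', div_self hn'.ne']
  have hp : ∀ i ∈ Finset.univ, p i ∈ Ω := by
    intro i _
    fin_cases i
    exacts [ha, hb, hc]
  have hz : ∑ i, w i • p i = point h θ ξ z := by
    simp only [w, p, Fin.sum_univ_three, Matrix.cons_val]
    rw [← smul_right_injective Plane hn'.ne' |>.eq_iff]
    simp only [smul_add, smul_smul, mul_div_cancel₀ _ hn'.ne']
    ext i
    fin_cases i
    · simp [point, rot, lat]
      linear_combination (-h * Real.cos θ) * h1' + h * Real.sin θ * h2' +
        h * (Real.cos θ * ξ 0 - Real.sin θ * ξ 1) * hsum'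
    · simp [point, rot, lat]
      linear_combination (-h * Real.sin θ) * h1' - h * Real.cos θ * h2' +
        h * (Real.sin θ * ξ 0 + Real.cos θ * ξ 1) * hsum'
  refine ⟨?_, ?_⟩
  · show point h θ ξ z ∈ Ω
    rw [← hz]
    exact hU.1.sum_mem hw0 hw1 hp
  · have := hU.map_sum_le hw0 hw1 hp
    rw [hz] at this
    simp only [w, p, Fin.sum_univ_three, Matrix.cons_val, smul_eq_mul] at this
    have h3 := mul_le_mul_of_nonneg_left this hn'.le
    refine h3.trans (le_of_eq ?_)
    field_simp

theorem isStencils_and_mem_iff (hh : 0 < h) {U : Plane → ℝ} (hU : ConvexOn ℝ Ω U)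
    {u : grid Ω h θ ξ → ℝ} (hu : ∀ x : grid Ω h θ ξ, u x = U x)
    {ζ : grid Ω h θ ξ → ℤ × ℤ} (hζ : ∀ x, point h θ ξ (ζ x) = x)
    {W : grid Ω h θ ξ → Set (ℤ × ℤ)} :
    (IsStencils h θ (grid Ω h θ ξ) W ∧ u ∈ ConvStencils h θ (grid Ω h θ ξ) W) ↔
      ∀ x, IsGood (latticeSet Ω h θ ξ) (fun z => U (point h θ ξ z)) (ζ x) (W x) := by
  have hZ := isLatticeConvex_latticeSet (h := h) (θ := θ) (ξ := ξ) hU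
  have hpt : ∀ (x : grid Ω h θ ξ) e, (x : Plane) + disp h θ e = point h θ ξ (ζ x + e) := by
    intro x e; rw [point_add, hζ]
  have hpt' : ∀ (x : grid Ω h θ ξ) e, (x : Plane) - disp h θ e = point h θ ξ (ζ x - e) := by
    intro x e; rw [sub_eq_add_neg, sub_eq_add_neg, point_add, hζ, disp_neg]
  have hζZ : ∀ x : grid Ω h θ ξ, ζ x ∈ latticeSet Ω h θ ξ := by
    intro x; rw [← point_mem_grid hh, hζ]; exact x.2
  have hmax : ∀ x, maxStencil h θ (grid Ω h θ ξ) x = maxAt (latticeSet Ω h θ ξ) (ζ x) := by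
    intro x
    ext e
    simp only [maxStencil, maxAt, Set.mem_ofPred_eq, hpt, point_mem_grid hh]
  have hux : ∀ x, u x = U (point h θ ξ (ζ x)) := by intro x; rw [hu, hζ]
  constructor
  · rintro ⟨hW, hm⟩ x
    refine ⟨hmax x ▸ hW.subset_max x, hmax x ▸ hW.stability x, hmax x ▸ hW.visibility x, ?_⟩
    intro e he heW f g hp hf hg
    have hf' := hmax x ▸ hW.subset_max x hf
    have hg' := hmax x ▸ hW.subset_max x hg
    have := hm.parallelogram x e ⟨(hmax x).symm ▸ he, heW, f, g, hp, hf, hg⟩ f g hp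
      ⟨_, (point_mem_grid hh).2 he.2⟩ ⟨_, (point_mem_grid hh).2 hf'.2⟩
      ⟨_, (point_mem_grid hh).2 hg'.2⟩ (hpt x e).symm (hpt x f).symm (hpt x g).symm
    simp only [hu] at this
    rw [← hζ x] at this
    linarith
  · intro hW
    refine ⟨⟨fun x => (hmax x).symm ▸ (hW x).subset_max, fun x => (hmax x).symm ▸ (hW x).stable,
      fun x => (hmax x).symm ▸ (hW x).visible⟩, ⟨?_, ?_, ?_⟩⟩
    · intro x e he p q hp hq
      rw [hpt] at hp
      rw [hpt'] at hq
      have h1 := p.2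
      have h2 := q.2
      rw [hp, point_mem_grid hh] at h1
      rw [hq, point_mem_grid hh] at h2
      have := (hZ _ h1 _ h2 _ h1 1 1 0 2 (by norm_num) (by norm_num) le_rfl (by norm_num)
        (by norm_num) (ζ x) (by simp; ring) (by simp; ring)).2
      rw [hu p, hu q, hp, hq, hux x]
      push_cast at this
      linarith
    · intro x e he f g hfg p q r hp hq hr
      rw [hpt] at hp
      rw [hpt'] at hq hr
      have h1 := p.2
      have h2 := q.2
      have h3 := r.2
      rw [hp, point_mem_grid hh] at h1
      rw [hq, point_mem_grid hh] at h2
      rw [hr, point_mem_grid hh] at h3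
      have := (hZ _ h1 _ h2 _ h3 1 1 1 3 (by norm_num) (by norm_num) (by norm_num) (by norm_num)
        (by norm_num) (ζ x) (by rw [hfg.eq_add]; simp; ring) (by rw [hfg.eq_add]; simp; ring)).2
      rw [hu p, hu q, hu r, hp, hq, hr, hux x]
      push_cast at this
      linarith
    · rintro x e ⟨he, heW, f', g', hp', hf', hg'⟩ f g hfg p q r hp hq hr
      obtain ⟨rfl, rfl⟩ := hfg.unique hp'
      rw [hpt] at hp hq hr
      have := (hW x).closed e (hmax x ▸ he) heW _ _ hfg hf' hg'
      rw [hu p, hu q, hu r, hp, hq, hr, hux x]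
      linarith

end

end GridConvex

theorem mainTheorem9 :
    ∃ C : ℝ, ∀ (Ω : Set GridConvex.Plane), Convex ℝ Ω → IsCompact Ω →
      ∀ (h : ℝ), 0 < h → ∀ (θ : ℝ) (ξ : GridConvex.Plane),
      ∀ u ∈ GridConvex.Conv Ω (GridConvex.grid Ω h θ ξ),
        ∃ V : GridConvex.grid Ω h θ ξ → Set (ℤ × ℤ),
          IsLeast {W | GridConvex.IsStencils h θ (GridConvex.grid Ω h θ ξ) W ∧
            u ∈ GridConvex.ConvStencils h θ (GridConvex.grid Ω h θ ξ) W} V ∧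
          (GridConvex.pairs V).Finite ∧
          ((GridConvex.pairs V).ncard : ℝ) ≤
            C * ((GridConvex.grid Ω h θ ξ).ncard : ℝ) * (Metric.diam Ω / h) := by
  refine ⟨46, fun Ω _ hΩ h hh θ ξ u hu => ?_⟩
  obtain ⟨U, hU, hu⟩ := hu
  set Z := GridConvex.latticeSet Ω h θ ξ with hZdef
  set v : ℤ × ℤ → ℝ := fun z => U (GridConvex.point h θ ξ z) with hv
  have hZ : GridConvex.IsLatticeConvex Z v := GridConvex.isLatticeConvex_latticeSet hU
  have hfin : Z.Finite := GridConvex.finite_latticeSet hΩ hh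
  have hcoord : ∀ x : GridConvex.grid Ω h θ ξ, ∃ z, GridConvex.point h θ ξ z = x := by
    rintro ⟨_, -, z, rfl⟩
    exact ⟨z, rfl⟩
  choose ζ hζ using hcoord
  have hζZ : ∀ x, ζ x ∈ Z := fun x => by
    rw [hZdef, ← GridConvex.point_mem_grid hh, hζ]; exact x.2
  have hζi : Function.Injective ζ := fun x y hxy => Subtype.ext (by rw [← hζ x, ← hζ y, hxy])
  have hiff := fun W => GridConvex.isStencils_and_mem_iff hh hU hu hζ (W := W)
  refine ⟨fun x => GridConvex.minAt Z v (ζ x), ⟨?_, ?_⟩, ?_⟩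
  · exact (hiff _).2 fun x => GridConvex.isGood_minAt hZ (hζZ x)
  · intro W hW x e he
    exact he _ ((hiff W).1 hW x)
  set D := Metric.diam Ω / h with hD
  have hD0 : 0 ≤ D := div_nonneg Metric.diam_nonneg hh.le
  obtain ⟨hBf, hBc⟩ := GridConvex.ncard_negPairs_le hZ hfin (K := 2 * ⌊D⌋₊) (by
    intro x hx e hxe
    have := GridConvex.abs_le_floor hΩ hh hx hxe
    rw [← hD] at this
    simp only [GridConvex.l1]
    push_cast
    omega)
  let F : GridConvex.grid Ω h θ ξ × (ℤ × ℤ) → (ℤ × ℤ) × (ℤ × ℤ) := fun p => (ζ p.1, p.2)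
  have hFi : Function.Injective F := hζi.prodMap Function.injective_id
  have hFm : Set.MapsTo F (GridConvex.pairs fun x => GridConvex.minAt Z v (ζ x))
      (GridConvex.negPairs Z v) := fun p hp =>
    ⟨hζZ _, hp _ (GridConvex.isGood_negAt hZ (hζZ _))⟩
  refine ⟨Set.Finite.of_injOn hFm hFi.injOn hBf, ?_⟩
  have hN : (GridConvex.grid Ω h θ ξ).ncard = Z.ncard := by
    rw [GridConvex.grid_eq_image, Set.ncard_image_of_injective _ (GridConvex.point_injective hh)]
  rw [hN]
  have hcard := Set.ncard_le_ncard_of_injOn F hFm hFi.injOn hBf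
  rcases (GridConvex.negPairs Z v).eq_empty_or_nonempty with h0 | ⟨⟨x, e⟩, hx, he⟩
  · rw [h0, Set.ncard_empty, Nat.le_zero] at hcard
    rw [hcard, Nat.cast_zero]
    exact mul_nonneg (by positivity) hD0
  · have h1 : 1 ≤ D := by
      have h2 := GridConvex.ip_self_le hΩ hh hx he.1.2
      have h3 : (1 : ℝ) ≤ (GridConvex.ip e e : ℤ) := by exact_mod_cast he.1.1.ip_self_pos
      nlinarith
    have h2 : (⌊D⌋₊ : ℝ) ≤ D := Nat.floor_le hD0
    have h3 := hcard.trans hBc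
    have h4 : ((4 + 14 * (2 * ⌊D⌋₊ + 1) : ℕ) : ℝ) ≤ 46 * D := by push_cast; linarith
    calc _ ≤ (((4 + 14 * (2 * ⌊D⌋₊ + 1)) * Z.ncard : ℕ) : ℝ) := by exact_mod_cast h3
      _ = ((4 + 14 * (2 * ⌊D⌋₊ + 1) : ℕ) : ℝ) * Z.ncard := by push_cast; ring
      _ ≤ 46 * D * Z.ncard := mul_le_mul_of_nonneg_right h4 (by positivity)
      _ = 46 * Z.ncard * D := by ring
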